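/- Let $\mathbb K$ be a field and $\rho\ge 0$ an integer. **Assigned graphs.** A graph is finite and made of half-edges attached to vertices; an internal edge is a pair of half-edges, an external edge is a single half-edge. All vertices have valence four, or two (two-valent vertices are the ones that arise by shrinking two-point subgraphs). A graph is 1PI if it has at least one internal edge, is connected, and stays connected when any one internal edge is cut. An assigned graph $(G,\mu)$ is the isomorphism class of a 1PI graph $G$ together with a scale $\mu(\ell)\in\{0,\dots,\rho\}$ for each internal edge $\ell$; external edges are unlabelled. Fix one of two conventions for external edges: (a) they carry no scale; (b) each of them carries either no scale or a scale in $\{0,\dots,\rho\}$. An absent scale is regarded as lower than all scales. **High subgraphs.** A subgraph $g$ of $G$ is a set of internal edges of $G$ together with their end points; its external edges are all half-edges of $G$ attached to its vertices that do not belong to its internal edges. The internal edges of $g$ keep their scales; when $g$ is regarded as an assigned graph of its own, its external edges lose their scales under (a) and keep those that they have in $G$ under (b). A connected subgraph $g$ is high if, for the scales in $G$, every internal edge of $g$ has a scale strictly larger than every external edge of $g$. Let $\underline{(G,\mu)}$ be the set of non-empty subgraphs $g$ of $G$, not containing all internal edges of $G$, each of whose connected components is 1PI, high, and has two or four external edges.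 For $g\in\underline{(G,\mu)}$ with components $g_1,\dots,g_k$, the cograph $G/g$ is obtained by replacing each $g_i$ by a vertex to which the external edges of $g_i$ are attached, the remaining edges keeping their scales. **Operations.** Let $\mathcal H$ be the free commutative unital $\mathbb K$-algebra on all assigned graphs; its product is the disjoint union, its unit $1$ the empty graph, and a subgraph $g\in\underline{(G,\mu)}$ is identified with the product of its components. Let $\Delta:\mathcal H\to\mathcal H\otimes\mathcal H$, $\varepsilon:\mathcal H\to\mathbb K$ and $S:\mathcal H\to\mathcal H$ be the unital algebra morphisms given on assigned graphs by $$\Delta(G)=G\otimes 1+1\otimes G+\sum_{g\in\underline{(G,\mu)}} g\otimes G/g,\qquad \varepsilon(G)=0,\qquad S(G)=-G-\sum_{g\in\underline{(G,\mu)}}S(g)\,(G/g),$$ the last formula being a recursion on the number of internal edges. **Theorem.** $(\mathcal H,\Delta,\varepsilon,S)$ is a Hopf algebra: $\Delta$ is coassociative, $\varepsilon$ is a counit for $\Delta$, both are unital algebra morphisms, and $m\circ(S\otimes\mathrm{id})\circ\Delta=u\circ\varepsilon=m\circ(\mathrm{id}\otimes S)\circ\Delta$, where $m$ is the product and $u$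 the unit map; moreover $S$ satisfies the above recursion. Further, the number of independent loops and the number of internal edges each define a grading $\mathcal H=\bigoplus_{n\ge0}\mathcal H^{(n)}$, additive under disjoint union, with $\mathcal H^{(m)}\mathcal H^{(n)}\subseteq\mathcal H^{(m+n)}$, $\Delta\mathcal H^{(n)}\subseteq\bigoplus_{k=0}^n\mathcal H^{(k)}\otimes\mathcal H^{(n-k)}$ and $\mathcal H^{(0)}=\mathbb K\,1$. -/

import Mathlib

open scoped TensorProduct

namespace AssignedGraphs

/-! ### Feynman graphs with scales -/

/-- A finite graph in half-edge form. Two half-edges exchanged by `inv` form an internal edge;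
a half-edge fixed by `inv` is an external edge. Every edge has a scale, the two halves of an
internal edge having the same one; the value `⊥` stands for the absence of a scale. -/
structure ScaledGraph where
  V : Type
  H : Type
  finV : Finite V
  finH : Finite H
  vert : H → V
  inv : H → H
  inv_inv : ∀ h, inv (inv h) = h
  scale : H → WithBot ℕ
  scale_inv : ∀ h, scale (inv h) = scale h

attribute [instance] ScaledGraph.finV ScaledGraph.finH

/-- The two usual conventions on the external edges of an assigned graph.
`forget`: only internal edges carry a scale; a subgraph, regarded as an assigned graph on its own,
forgets the scales which its external edges have in the ambient graph.
`keep`: external edges may carry a scale too, and a subgraph keeps the scales which its external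
edges have in the ambient graph. -/
inductive LegConvention
  | forget
  | keep

/-- The scale which an external edge of a subgraph retains, from its scale in the ambient graph. -/
def LegConvention.leg : LegConvention → WithBot ℕ → WithBot ℕ
  | .forget, _ => ⊥
  | .keep, s => s

namespace ScaledGraph

/-- Half-edges belonging to internal edges. -/
def internal (G : ScaledGraph) : Set G.H := {h | G.inv h ≠ h}

/-- External edges. -/
def external (G : ScaledGraph) : Set G.H := {h | G.inv h = h}

/-- `v` and `w` are joined by a path using only internal edges with half-edges in `s`. -/
def Linked (G : ScaledGraph) (s : Set G.H) : G.V → G.V → Prop :=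
  Relation.EqvGen fun v w => ∃ h ∈ s, G.vert h = v ∧ G.vert (G.inv h) = w

/-- One particle irreducible graphs: connected, with at least one internal edge, and still
connected after cutting any one internal edge. -/
structure IsOnePI (G : ScaledGraph) : Prop where
  nonempty : G.internal.Nonempty
  connected : ∀ v w, G.Linked G.internal v w
  bridgeless : ∀ e ∈ G.internal, ∀ v w, G.Linked (G.internal \ {e, G.inv e}) v w

/-- `G` is a 1PI graph with vertices of valence four or two (the latter being those produced by
shrinking two-point subgraphs) whose internal edges carry scales in `{0, …, ρ}`; the external edges
carry no scale (convention `forget`), or either no scale or one in `{0, …, ρ}`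
(convention `keep`). -/
structure IsAssigned (c : LegConvention) (ρ : ℕ) (G : ScaledGraph) : Prop where
  valence : ∀ v, Nat.card {h // G.vert h = v} = 2 ∨ Nat.card {h // G.vert h = v} = 4
  onePI : G.IsOnePI
  scale_le : ∀ h, G.scale h ≤ (ρ : WithBot ℕ)
  internal_scale : ∀ h ∈ G.internal, G.scale h ≠ ⊥
  external_scale : ∀ h ∈ G.external, c.leg (G.scale h) = G.scale h

/-- Isomorphisms of graphs with scales; external edges are not labelled. -/
structure Iso (G G' : ScaledGraph) where
  onV : G.V ≃ G'.V
  onH : G.H ≃ G'.H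
  vert : ∀ h, G'.vert (onH h) = onV (G.vert h)
  inv : ∀ h, G'.inv (onH h) = onH (G.inv h)
  scale : ∀ h, G'.scale (onH h) = G.scale h

/-! ### Subgraphs -/

/-- A subgraph, given by a set of internal edges; its vertices are the end points of these. -/
@[ext] structure Subgraph (G : ScaledGraph) where
  carrier : Set G.H
  inv_mem : ∀ h ∈ carrier, G.inv h ∈ carrier
  subset_internal : carrier ⊆ G.internal

namespace Subgraph

/-- The vertices of a subgraph. -/
def support {G : ScaledGraph} (γ : G.Subgraph) : Set G.V := G.vert '' γ.carrier

/-- The external edges of a subgraph: all half-edges of `G` attached to its vertices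
that do not belong to its internal edges. -/
def legs {G : ScaledGraph} (γ : G.Subgraph) : Set G.H :=
  {h | G.vert h ∈ γ.support ∧ h ∉ γ.carrier}

theorem inv_mem_iff {G : ScaledGraph} (γ : G.Subgraph) (h : G.H) :
    G.inv h ∈ γ.carrier ↔ h ∈ γ.carrier :=
  ⟨fun hh => by simpa [G.inv_inv] using γ.inv_mem _ hh, γ.inv_mem h⟩

open Classical in
/-- A subgraph as a graph on its own. -/
noncomputable def toGraph (c : LegConvention) {G : ScaledGraph} (γ : G.Subgraph) :
    ScaledGraph where
  V := γ.support
  H := {h // G.vert h ∈ γ.support}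
  finV := inferInstance
  finH := inferInstance
  vert h := ⟨G.vert h.1, h.2⟩
  inv h := if hh : h.1 ∈ γ.carrier then ⟨G.inv h.1, G.inv h.1, γ.inv_mem _ hh, rfl⟩ else h
  inv_inv h := by
    by_cases hh : h.1 ∈ γ.carrier
    · simp [hh, γ.inv_mem _ hh, G.inv_inv]
    · simp [hh]
  scale h := if h.1 ∈ γ.carrier then G.scale h.1 else c.leg (G.scale h.1)
  scale_inv h := by
    by_cases hh : h.1 ∈ γ.carrier
    · simp [hh, γ.inv_mem _ hh, G.scale_inv]
    · simp [hh]

theorem toGraph_inv_pos (c : LegConvention) {G : ScaledGraph} (γ : G.Subgraph)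
    {h : (γ.toGraph c).H} (hh : h.1 ∈ γ.carrier) : ((γ.toGraph c).inv h).1 = G.inv h.1 := by
  exact congrArg Subtype.val (dif_pos hh)

theorem toGraph_inv_neg (c : LegConvention) {G : ScaledGraph} (γ : G.Subgraph)
    {h : (γ.toGraph c).H} (hh : h.1 ∉ γ.carrier) : (γ.toGraph c).inv h = h := by
  exact dif_neg hh

theorem toGraph_scale_pos (c : LegConvention) {G : ScaledGraph} (γ : G.Subgraph)
    {h : (γ.toGraph c).H} (hh : h.1 ∈ γ.carrier) : (γ.toGraph c).scale h = G.scale h.1 := by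
  exact if_pos hh

theorem toGraph_scale_neg (c : LegConvention) {G : ScaledGraph} (γ : G.Subgraph)
    {h : (γ.toGraph c).H} (hh : h.1 ∉ γ.carrier) :
    (γ.toGraph c).scale h = c.leg (G.scale h.1) := by
  exact if_neg hh

/-- Connected 1PI subgraphs with two or four external edges which are high: the scale of every
internal edge is strictly larger than the scale of every external edge (an external edge without
scale lies below all scales). -/
structure IsHighDivergent (c : LegConvention) {G : ScaledGraph} (γ : G.Subgraph) : Prop where
  onePI : (γ.toGraph c).IsOnePI
  points : Nat.card γ.legs = 2 ∨ Nat.card γ.legs = 4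
  high : ∀ h ∈ γ.carrier, ∀ l ∈ γ.legs, G.scale l < G.scale h

end Subgraph

/-- The connected high 1PI two- and four-point subgraphs of `G`. -/
abbrev HighSubgraph (c : LegConvention) (G : ScaledGraph) :=
  {γ : G.Subgraph // γ.IsHighDivergent c}

instance (G : ScaledGraph) : Finite G.Subgraph :=
  Finite.of_injective Subgraph.carrier fun _ _ h => Subgraph.ext h

/-- `F` is the set of connected components of a subgraph over which the coproduct of `G` sums:
it is non-empty, its members are pairwise disjoint, and they do not exhaust the internal edges
of `G`. -/
structure IsExtraction (c : LegConvention) {G : ScaledGraph} (F : Finset (G.HighSubgraph c)) :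
    Prop where
  nonempty : F.Nonempty
  disjoint : ∀ γ ∈ F, ∀ γ' ∈ F, γ ≠ γ' → Disjoint γ.1.support γ'.1.support
  proper : ∃ h ∈ G.internal, ∀ γ ∈ F, h ∉ γ.1.carrier

/-- The families over which the coproduct of `G` sums. -/
abbrev Extraction (c : LegConvention) (G : ScaledGraph) :=
  {F : Finset (G.HighSubgraph c) // IsExtraction c F}

/-- The cograph: every member of `F` is shrunk to a vertex; all other edges keep their scales. -/
def shrink (c : LegConvention) (G : ScaledGraph) (F : Finset (G.HighSubgraph c)) :
    ScaledGraph where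
  V := Quot fun v w : G.V => ∃ γ ∈ F, v ∈ γ.1.support ∧ w ∈ γ.1.support
  H := {h : G.H // ∀ γ ∈ F, h ∉ γ.1.carrier}
  finV := inferInstance
  finH := inferInstance
  vert h := Quot.mk _ (G.vert h.1)
  inv h := ⟨G.inv h.1, fun γ hγ hh => h.2 γ hγ ((γ.1.inv_mem_iff _).1 hh)⟩
  inv_inv _ := Subtype.ext (G.inv_inv _)
  scale h := G.scale h.1
  scale_inv _ := G.scale_inv _

/-! ### Subgraphs and cographs of assigned graphs are assigned graphs -/

theorem toGraph_isAssigned {c : LegConvention} {ρ : ℕ} {G : ScaledGraph} (hG : G.IsAssigned c ρ)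
    (γ : G.HighSubgraph c) : (γ.1.toGraph c).IsAssigned c ρ where
  valence v := by
    have e : {h // (γ.1.toGraph c).vert h = v} ≃ {h // G.vert h = v.1} :=
      { toFun := fun h => ⟨h.1.1, congrArg Subtype.val h.2⟩
        invFun := fun h => ⟨⟨h.1, by rw [h.2]; exact v.2⟩, Subtype.ext h.2⟩
        left_inv := fun _ => rfl
        right_inv := fun _ => rfl }
    rw [Nat.card_congr e]
    exact hG.valence v.1
  onePI := γ.2.onePI
  scale_le h := by
    by_cases hh : h.1 ∈ γ.1.carrier
    · rw [Subgraph.toGraph_scale_pos c γ.1 hh]; exact hG.scale_le h.1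
    · rw [Subgraph.toGraph_scale_neg c γ.1 hh]
      cases c
      · exact bot_le
      · exact hG.scale_le h.1
  internal_scale h hi := by
    by_cases hh : h.1 ∈ γ.1.carrier
    · rw [Subgraph.toGraph_scale_pos c γ.1 hh]
      exact hG.internal_scale h.1 (γ.1.subset_internal hh)
    · exact absurd (Subgraph.toGraph_inv_neg c γ.1 hh) hi
  external_scale h he := by
    by_cases hh : h.1 ∈ γ.1.carrier
    · have h2 := Subgraph.toGraph_inv_pos c γ.1 hh
      have h1 : (γ.1.toGraph c).inv h = h := he
      rw [h1] at h2
      exact absurd h2.symm (γ.1.subset_internal hh)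
    · rw [Subgraph.toGraph_scale_neg c γ.1 hh]
      cases c <;> rfl

theorem shrink_mk_eq_iff {c : LegConvention} {G : ScaledGraph} {F : Finset (G.HighSubgraph c)}
    (hF : IsExtraction c F) (v w : G.V) :
    ((Quot.mk _ v : (G.shrink c F).V) = Quot.mk _ w) ↔
      v = w ∨ ∃ γ ∈ F, v ∈ γ.1.support ∧ w ∈ γ.1.support := by
  refine ⟨fun h => ?_, ?_⟩
  · have h' := Quot.eqvGen_exact h
    clear h
    induction h' with
    | rel _ _ hr => exact Or.inr hr
    | refl _ => exact Or.inl rfl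
    | symm _ _ _ ih =>
      rcases ih with rfl | ⟨γ, hγ, h1, h2⟩
      · exact Or.inl rfl
      · exact Or.inr ⟨γ, hγ, h2, h1⟩
    | trans _ _ _ _ _ ih1 ih2 =>
      rcases ih1 with rfl | ⟨γ, hγ, h1, h2⟩
      · exact ih2
      · rcases ih2 with rfl | ⟨γ', hγ', h3, h4⟩
        · exact Or.inr ⟨γ, hγ, h1, h2⟩
        · by_cases hne : γ = γ'
          · subst hne; exact Or.inr ⟨γ, hγ, h1, h4⟩
          · exact absurd h3 (Set.disjoint_left.1 (hF.disjoint γ hγ γ' hγ' hne) h2)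
  · rintro (rfl | h)
    · rfl
    · exact Quot.sound h

theorem shrink_linked {c : LegConvention} {G : ScaledGraph} {F : Finset (G.HighSubgraph c)}
    {s : Set G.H} {t : Set (G.shrink c F).H}
    (hst : ∀ (h : G.H) (hh : ∀ γ ∈ F, h ∉ γ.1.carrier), h ∈ s → (⟨h, hh⟩ : (G.shrink c F).H) ∈ t)
    {v w : G.V} (h : G.Linked s v w) : (G.shrink c F).Linked t (Quot.mk _ v) (Quot.mk _ w) := by
  induction h with
  | rel x y h =>
    obtain ⟨h, hs, rfl, rfl⟩ := h
    by_cases hh : ∀ γ ∈ F, h ∉ γ.1.carrier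
    · exact .rel _ _ ⟨⟨h, hh⟩, hst h hh hs, rfl, rfl⟩
    · push Not at hh
      obtain ⟨γ, hγ, hm⟩ := hh
      have : (Quot.mk _ (G.vert h) : (G.shrink c F).V) = Quot.mk _ (G.vert (G.inv h)) :=
        Quot.sound ⟨γ, hγ, ⟨h, hm, rfl⟩, ⟨_, γ.1.inv_mem _ hm, rfl⟩⟩
      rw [this]
      exact .refl _
  | refl x => exact .refl _
  | symm x y _ ih => exact .symm _ _ ih
  | trans x y z _ _ ih1 ih2 => exact .trans _ _ _ ih1 ih2

theorem shrink_isAssigned {c : LegConvention} {ρ : ℕ} {G : ScaledGraph} (hG : G.IsAssigned c ρ)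
    (F : G.Extraction c) : (G.shrink c F.1).IsAssigned c ρ where
  valence v := by
    obtain ⟨v, rfl⟩ := Quot.exists_rep v
    by_cases hv : ∃ γ ∈ F.1, v ∈ γ.1.support
    · obtain ⟨γ, hγ, hv⟩ := hv
      have key : ∀ h : G.H, ((∀ γ ∈ F.1, h ∉ γ.1.carrier) ∧
          (Quot.mk _ (G.vert h) : (G.shrink c F.1).V) = Quot.mk _ v) ↔ h ∈ γ.1.legs := by
        intro h
        rw [shrink_mk_eq_iff F.2]
        constructor
        · rintro ⟨h1, h2⟩
          refine ⟨?_, h1 γ hγ⟩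
          rcases h2 with h2 | ⟨γ', hγ', h2, h3⟩
          · rw [h2]; exact hv
          · by_cases hne : γ = γ'
            · subst hne; exact h2
            · exact absurd h3 (Set.disjoint_left.1 (F.2.disjoint γ hγ γ' hγ' hne) hv)
        · rintro ⟨h1, h2⟩
          refine ⟨fun γ' hγ' hm => ?_, Or.inr ⟨γ, hγ, h1, hv⟩⟩
          by_cases hne : γ = γ'
          · subst hne; exact h2 hm
          · exact Set.disjoint_left.1 (F.2.disjoint γ hγ γ' hγ' hne) h1 ⟨h, hm, rfl⟩
      have e : {h // (G.shrink c F.1).vert h = Quot.mk _ v} ≃ γ.1.legs :=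
        { toFun := fun h => ⟨h.1.1, (key _).1 ⟨h.1.2, h.2⟩⟩
          invFun := fun h => ⟨⟨h.1, ((key _).2 h.2).1⟩, ((key _).2 h.2).2⟩
          left_inv := fun _ => rfl
          right_inv := fun _ => rfl }
      rw [Nat.card_congr e]
      exact γ.2.points
    · push Not at hv
      have key : ∀ h : G.H, ((∀ γ ∈ F.1, h ∉ γ.1.carrier) ∧
          (Quot.mk _ (G.vert h) : (G.shrink c F.1).V) = Quot.mk _ v) ↔ G.vert h = v := by
        intro h
        rw [shrink_mk_eq_iff F.2]
        constructor
        · rintro ⟨_, h2 | ⟨γ', hγ', _, h3⟩⟩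
          · exact h2
          · exact absurd h3 (hv γ' hγ')
        · intro h1
          exact ⟨fun γ' hγ' hm => hv γ' hγ' ⟨h, hm, h1⟩, Or.inl h1⟩
      have e : {h // (G.shrink c F.1).vert h = Quot.mk _ v} ≃ {h // G.vert h = v} :=
        { toFun := fun h => ⟨h.1.1, (key _).1 ⟨h.1.2, h.2⟩⟩
          invFun := fun h => ⟨⟨h.1, ((key _).2 h.2).1⟩, ((key _).2 h.2).2⟩
          left_inv := fun _ => rfl
          right_inv := fun _ => rfl }
      rw [Nat.card_congr e]
      exact hG.valence v
  onePI :=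
    { nonempty := by
        obtain ⟨h, hi, hh⟩ := F.2.proper
        exact ⟨⟨h, hh⟩, fun h' => hi (congrArg Subtype.val h')⟩
      connected := by
        intro v w
        obtain ⟨v, rfl⟩ := Quot.exists_rep v
        obtain ⟨w, rfl⟩ := Quot.exists_rep w
        refine shrink_linked (s := G.internal) ?_ (hG.onePI.connected v w)
        exact fun h hh hi h' => hi (congrArg Subtype.val h')
      bridgeless := by
        intro e he v w
        obtain ⟨v, rfl⟩ := Quot.exists_rep v
        obtain ⟨w, rfl⟩ := Quot.exists_rep w
        refine shrink_linked (s := G.internal \ {e.1, G.inv e.1}) ?_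
          (hG.onePI.bridgeless e.1 (fun h' => he (Subtype.ext h')) v w)
        rintro h hh ⟨hi, hn⟩
        refine ⟨fun h' => hi (congrArg Subtype.val h'), ?_⟩
        rintro (h' | h')
        · exact hn (Or.inl (congrArg Subtype.val h'))
        · exact hn (Or.inr (congrArg Subtype.val h')) }
  scale_le h := hG.scale_le h.1
  internal_scale h hi := hG.internal_scale h.1 fun h' => hi (Subtype.ext h')
  external_scale h he := hG.external_scale h.1 (congrArg Subtype.val he)

/-! ### Invariance under isomorphism -/

namespace Iso

/-- The identity. -/
def refl (G : ScaledGraph) : G.Iso G := ⟨.refl _, .refl _, fun _ => rfl, fun _ => rfl, fun _ => rfl⟩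

/-- The inverse of an isomorphism. -/
def symm {G G' : ScaledGraph} (e : G.Iso G') : G'.Iso G where
  onV := e.onV.symm
  onH := e.onH.symm
  vert h := by rw [Equiv.eq_symm_apply, ← e.vert, Equiv.apply_symm_apply]
  inv h := by rw [Equiv.eq_symm_apply, ← e.inv, Equiv.apply_symm_apply]
  scale h := by rw [← e.scale, Equiv.apply_symm_apply]

/-- The composite of two isomorphisms. -/
def trans {G G' G'' : ScaledGraph} (e : G.Iso G') (f : G'.Iso G'') : G.Iso G'' where
  onV := e.onV.trans f.onV
  onH := e.onH.trans f.onH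
  vert h := by simp [e.vert, f.vert]
  inv h := by simp [e.inv, f.inv]
  scale h := by simp [e.scale, f.scale]

theorem mem_internal {G G' : ScaledGraph} (e : G.Iso G') (h : G.H) :
    e.onH h ∈ G'.internal ↔ h ∈ G.internal := by
  simp [internal, e.inv]

theorem linked {G G' : ScaledGraph} (e : G.Iso G') {s : Set G.H} {t : Set G'.H}
    (hst : ∀ h ∈ s, e.onH h ∈ t) {v w : G.V} (h : G.Linked s v w) :
    G'.Linked t (e.onV v) (e.onV w) := by
  induction h with
  | rel x y h =>
    obtain ⟨h, hs, rfl, rfl⟩ := h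
    exact .rel _ _ ⟨e.onH h, hst h hs, e.vert h, by rw [e.inv, e.vert]⟩
  | refl x => exact .refl _
  | symm x y _ ih => exact .symm _ _ ih
  | trans x y z _ _ ih1 ih2 => exact .trans _ _ _ ih1 ih2

theorem isOnePI {G G' : ScaledGraph} (e : G.Iso G') (hG : G.IsOnePI) : G'.IsOnePI where
  nonempty := by
    obtain ⟨h, hh⟩ := hG.nonempty
    exact ⟨e.onH h, (e.mem_internal h).2 hh⟩
  connected v w := by
    obtain ⟨v, rfl⟩ := e.onV.surjective v
    obtain ⟨w, rfl⟩ := e.onV.surjective w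
    exact e.linked (fun h hh => (e.mem_internal h).2 hh) (hG.connected v w)
  bridgeless a ha v w := by
    obtain ⟨v, rfl⟩ := e.onV.surjective v
    obtain ⟨w, rfl⟩ := e.onV.surjective w
    obtain ⟨a, rfl⟩ := e.onH.surjective a
    refine e.linked ?_ (hG.bridgeless a ((e.mem_internal a).1 ha) v w)
    rintro h ⟨hi, hn⟩
    refine ⟨(e.mem_internal h).2 hi, ?_⟩
    rw [e.inv]
    rintro (h' | h')
    · exact hn (Or.inl (e.onH.injective h'))
    · exact hn (Or.inr (e.onH.injective h'))

/-- The image of a subgraph under an isomorphism. -/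
def mapSubgraph {G G' : ScaledGraph} (e : G.Iso G') (γ : G.Subgraph) : G'.Subgraph where
  carrier := {h | e.onH.symm h ∈ γ.carrier}
  inv_mem h hh := by
    have := e.symm.inv h
    change e.onH.symm (G'.inv h) ∈ γ.carrier
    change G.inv (e.onH.symm h) = e.onH.symm (G'.inv h) at this
    rw [← this]
    exact γ.inv_mem _ hh
  subset_internal h hh := by
    have := γ.subset_internal hh
    simpa using (e.mem_internal _).2 this

theorem mem_mapSubgraph {G G' : ScaledGraph} (e : G.Iso G') (γ : G.Subgraph) (h : G.H) :
    e.onH h ∈ (e.mapSubgraph γ).carrier ↔ h ∈ γ.carrier := by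
  simp [mapSubgraph]

theorem mem_support {G G' : ScaledGraph} (e : G.Iso G') (γ : G.Subgraph) (v : G.V) :
    e.onV v ∈ (e.mapSubgraph γ).support ↔ v ∈ γ.support := by
  constructor
  · rintro ⟨h, hh, hv⟩
    obtain ⟨h, rfl⟩ := e.onH.surjective h
    rw [e.vert] at hv
    exact ⟨h, (e.mem_mapSubgraph γ h).1 hh, e.onV.injective hv⟩
  · rintro ⟨h, hh, rfl⟩
    exact ⟨e.onH h, (e.mem_mapSubgraph γ h).2 hh, e.vert h⟩

theorem mem_legs {G G' : ScaledGraph} (e : G.Iso G') (γ : G.Subgraph) (h : G.H) :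
    e.onH h ∈ (e.mapSubgraph γ).legs ↔ h ∈ γ.legs := by
  change (G'.vert (e.onH h) ∈ (e.mapSubgraph γ).support ∧
    e.onH h ∉ (e.mapSubgraph γ).carrier) ↔ (G.vert h ∈ γ.support ∧ h ∉ γ.carrier)
  rw [e.vert, e.mem_support, e.mem_mapSubgraph]

/-- Corresponding subgraphs are isomorphic. -/
noncomputable def toGraph {G G' : ScaledGraph} (e : G.Iso G') (c : LegConvention)
    (γ : G.Subgraph) : (γ.toGraph c).Iso ((e.mapSubgraph γ).toGraph c) where
  onV := e.onV.subtypeEquiv fun v => (e.mem_support γ v).symm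
  onH := e.onH.subtypeEquiv fun h => by rw [e.vert, e.mem_support]
  vert h := Subtype.ext (e.vert h.1)
  inv h := by
    apply Subtype.ext
    by_cases hh : h.1 ∈ γ.carrier
    · have h2 := (e.mem_mapSubgraph γ h.1).2 hh
      refine (Subgraph.toGraph_inv_pos c (e.mapSubgraph γ) h2).trans ((e.inv h.1).trans ?_)
      exact congrArg e.onH (Subgraph.toGraph_inv_pos c γ hh).symm
    · have h2 := mt (e.mem_mapSubgraph γ h.1).1 hh
      rw [Subgraph.toGraph_inv_neg c (e.mapSubgraph γ) h2, Subgraph.toGraph_inv_neg c γ hh]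
  scale h := by
    by_cases hh : h.1 ∈ γ.carrier
    · have h2 := (e.mem_mapSubgraph γ h.1).2 hh
      rw [Subgraph.toGraph_scale_pos c (e.mapSubgraph γ) h2, Subgraph.toGraph_scale_pos c γ hh]
      exact e.scale h.1
    · have h2 := mt (e.mem_mapSubgraph γ h.1).1 hh
      rw [Subgraph.toGraph_scale_neg c (e.mapSubgraph γ) h2, Subgraph.toGraph_scale_neg c γ hh]
      exact congrArg c.leg (e.scale h.1)

theorem isHighDivergent {G G' : ScaledGraph} (e : G.Iso G') (c : LegConvention)
    {γ : G.Subgraph} (hγ : γ.IsHighDivergent c) : (e.mapSubgraph γ).IsHighDivergent c where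
  onePI := (e.toGraph c γ).isOnePI hγ.onePI
  points := by
    rw [← Nat.card_congr (e.onH.subtypeEquiv fun h => (e.mem_legs γ h).symm)]
    exact hγ.points
  high h hh l hl := by
    obtain ⟨h, rfl⟩ := e.onH.surjective h
    obtain ⟨l, rfl⟩ := e.onH.surjective l
    rw [e.scale, e.scale]
    exact hγ.high h ((e.mem_mapSubgraph γ h).1 hh) l ((e.mem_legs γ l).1 hl)

/-- The bijection of high subgraphs induced by an isomorphism. -/
def onHigh {G G' : ScaledGraph} (e : G.Iso G') (c : LegConvention) :
    G.HighSubgraph c ≃ G'.HighSubgraph c where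
  toFun γ := ⟨e.mapSubgraph γ.1, e.isHighDivergent c γ.2⟩
  invFun γ := ⟨e.symm.mapSubgraph γ.1, e.symm.isHighDivergent c γ.2⟩
  left_inv γ := by
    apply Subtype.ext; apply Subgraph.ext; ext h
    simp [mapSubgraph, symm]
  right_inv γ := by
    apply Subtype.ext; apply Subgraph.ext; ext h
    simp [mapSubgraph, symm]

theorem isExtraction {G G' : ScaledGraph} (e : G.Iso G') (c : LegConvention)
    {F : Finset (G.HighSubgraph c)} (hF : IsExtraction c F) :
    IsExtraction c (F.map (e.onHigh c).toEmbedding) where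
  nonempty := by simpa using hF.nonempty
  disjoint γ hγ γ' hγ' hne := by
    obtain ⟨γ, h1, rfl⟩ := Finset.mem_map.1 hγ
    obtain ⟨γ', h2, rfl⟩ := Finset.mem_map.1 hγ'
    rw [Set.disjoint_left]
    intro v
    obtain ⟨v, rfl⟩ := e.onV.surjective v
    intro h3 h4
    exact Set.disjoint_left.1 (hF.disjoint γ h1 γ' h2 fun h => hne (by rw [h]))
      ((e.mem_support γ.1 v).1 h3) ((e.mem_support γ'.1 v).1 h4)
  proper := by
    obtain ⟨h, hi, hh⟩ := hF.proper
    refine ⟨e.onH h, (e.mem_internal h).2 hi, fun γ hγ => ?_⟩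
    obtain ⟨γ, h1, rfl⟩ := Finset.mem_map.1 hγ
    exact fun h2 => hh γ h1 ((e.mem_mapSubgraph γ.1 h).1 h2)

/-- The bijection of extractions induced by an isomorphism. -/
def onExtraction {G G' : ScaledGraph} (e : G.Iso G') (c : LegConvention) :
    G.Extraction c ≃ G'.Extraction c where
  toFun F := ⟨F.1.map (e.onHigh c).toEmbedding, e.isExtraction c F.2⟩
  invFun F := ⟨F.1.map (e.symm.onHigh c).toEmbedding, e.symm.isExtraction c F.2⟩
  left_inv F := by
    apply Subtype.ext
    change (F.1.map (e.onHigh c).toEmbedding).map (e.onHigh c).symm.toEmbedding = F.1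
    simp [Finset.map_map]
  right_inv F := by
    apply Subtype.ext
    change (F.1.map (e.onHigh c).symm.toEmbedding).map (e.onHigh c).toEmbedding = F.1
    simp [Finset.map_map]

/-- Corresponding cographs are isomorphic. -/
def shrink {G G' : ScaledGraph} (e : G.Iso G') (c : LegConvention)
    (F : Finset (G.HighSubgraph c)) :
    (G.shrink c F).Iso (G'.shrink c (F.map (e.onHigh c).toEmbedding)) where
  onV := Quot.congr e.onV fun v w => by
    constructor
    · rintro ⟨γ, hγ, h1, h2⟩
      exact ⟨e.onHigh c γ, Finset.mem_map_of_mem _ hγ, (e.mem_support _ _).2 h1,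
        (e.mem_support _ _).2 h2⟩
    · rintro ⟨γ, hγ, h1, h2⟩
      obtain ⟨γ, h3, rfl⟩ := Finset.mem_map.1 hγ
      exact ⟨γ, h3, (e.mem_support _ _).1 h1, (e.mem_support _ _).1 h2⟩
  onH := e.onH.subtypeEquiv fun h => by
    constructor
    · intro hh γ hγ
      obtain ⟨γ, h1, rfl⟩ := Finset.mem_map.1 hγ
      exact fun h2 => hh γ h1 ((e.mem_mapSubgraph γ.1 h).1 h2)
    · intro hh γ hγ h2
      exact hh (e.onHigh c γ) (Finset.mem_map_of_mem _ hγ) ((e.mem_mapSubgraph γ.1 h).2 h2)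
  vert h := congrArg (Quot.mk _) (e.vert h.1)
  inv h := Subtype.ext (e.inv h.1)
  scale h := e.scale h.1

end Iso

end ScaledGraph

open ScaledGraph

/-! ### Assigned graphs -/

/-- Isomorphism as an equivalence relation. -/
def assignedSetoid (c : LegConvention) (ρ : ℕ) : Setoid {G : ScaledGraph // G.IsAssigned c ρ} where
  r G G' := Nonempty (G.1.Iso G'.1)
  iseqv := ⟨fun G => ⟨Iso.refl G.1⟩, fun ⟨e⟩ => ⟨e.symm⟩, fun ⟨e⟩ ⟨f⟩ => ⟨e.trans f⟩⟩

/-- Assigned graphs with cutoff `ρ`: isomorphism classes of 1PI Feynman graphs with a scale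
assignment. -/
def AssignedGraph (c : LegConvention) (ρ : ℕ) := Quotient (assignedSetoid c ρ)

namespace AssignedGraph

variable {c : LegConvention} {ρ : ℕ}

/-- The isomorphism class of a graph. -/
def mk (G : ScaledGraph) (hG : G.IsAssigned c ρ) : AssignedGraph c ρ :=
  Quotient.mk (assignedSetoid c ρ) ⟨G, hG⟩

theorem mk_eq {G G' : ScaledGraph} (hG : G.IsAssigned c ρ) (hG' : G'.IsAssigned c ρ)
    (e : G.Iso G') : mk G hG = mk G' hG' :=
  Quotient.sound (s := assignedSetoid c ρ) ⟨e⟩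

/-- The components of the subgraph given by `F`, as a multiset of assigned graphs. -/
noncomputable def parts (G : ScaledGraph) (hG : G.IsAssigned c ρ) (F : G.Extraction c) :
    Multiset (AssignedGraph c ρ) :=
  F.1.val.map fun γ => mk (γ.1.toGraph c) (toGraph_isAssigned hG γ)

/-- The cograph of the subgraph given by `F`. -/
def cograph (G : ScaledGraph) (hG : G.IsAssigned c ρ) (F : G.Extraction c) : AssignedGraph c ρ :=
  mk (G.shrink c F.1) (shrink_isAssigned hG F)

open Classical in
/-- All pairs (components of `g`, cograph `G / g`), with multiplicity, where `g` runs over the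
non-empty subgraphs of `G`, different from `G`, whose connected components are high 1PI
two- or four-point subgraphs. -/
noncomputable def extractionsOf (G : ScaledGraph) (hG : G.IsAssigned c ρ) :
    Multiset (Multiset (AssignedGraph c ρ) × AssignedGraph c ρ) :=
  letI : Fintype (G.Extraction c) := Fintype.ofFinite _
  (Finset.univ : Finset (G.Extraction c)).val.map fun F => (parts G hG F, cograph G hG F)

theorem extractionsOf_eq {G G' : ScaledGraph} (hG : G.IsAssigned c ρ) (hG' : G'.IsAssigned c ρ)
    (e : G.Iso G') : extractionsOf G hG = extractionsOf G' hG' := by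
  classical
  let _ : Fintype (G.Extraction c) := Fintype.ofFinite _
  let _ : Fintype (G'.Extraction c) := Fintype.ofFinite _
  have key : ∀ F : G.Extraction c, (parts G hG F, cograph G hG F) =
      (parts G' hG' (e.onExtraction c F), cograph G' hG' (e.onExtraction c F)) := by
    intro F
    refine Prod.ext ?_ (mk_eq _ _ (e.shrink c F.1))
    simp only [parts, Iso.onExtraction, Equiv.coe_fn_mk, Finset.map_val, Multiset.map_map]
    exact Multiset.map_congr rfl fun γ _ => mk_eq _ _ (e.toGraph c γ.1)
  have h := Multiset.map_univ_val_equiv (e.onExtraction c)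
  unfold extractionsOf
  rw [Multiset.map_congr rfl fun F _ => key F, ← h, Multiset.map_map]
  rfl

/-- `extractionsOf` on isomorphism classes. -/
noncomputable def extractions (Γ : AssignedGraph c ρ) :
    Multiset (Multiset (AssignedGraph c ρ) × AssignedGraph c ρ) :=
  Quotient.lift (s := assignedSetoid c ρ) (fun G => extractionsOf G.1 G.2)
    (fun G G' ⟨e⟩ => extractionsOf_eq G.2 G'.2 e) Γ

/-- The number of internal edges. -/
noncomputable def numEdges (Γ : AssignedGraph c ρ) : ℕ :=
  Quotient.lift (s := assignedSetoid c ρ) (fun G => Nat.card G.1.internal / 2)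
    (fun G G' ⟨e⟩ => by
      have := Nat.card_congr (e.onH.subtypeEquiv fun h => (e.mem_internal h).symm)
      exact congrArg (· / 2) this) Γ

/-- The number of vertices. -/
noncomputable def numVertices (Γ : AssignedGraph c ρ) : ℕ :=
  Quotient.lift (s := assignedSetoid c ρ) (fun G => Nat.card G.1.V) (fun _ _ ⟨e⟩ => Nat.card_congr e.onV) Γ

/-- The number of independent loops of a (connected) graph. -/
noncomputable def numLoops (Γ : AssignedGraph c ρ) : ℕ := Γ.numEdges + 1 - Γ.numVertices

end AssignedGraph

/-! ### The algebra, the coproduct, the counit and the antipode -/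

/-- The free commutative unital algebra on the assigned graphs; its monomials are the disjoint
unions of assigned graphs, the monomial `1` being the empty graph. -/
abbrev HopfAlg (K : Type*) [Field K] (c : LegConvention) (ρ : ℕ) :=
  MvPolynomial (AssignedGraph c ρ) K

section Operations

variable (K : Type*) [Field K] (c : LegConvention) (ρ : ℕ)

/-- The disjoint union of a multiset of assigned graphs. -/
noncomputable def union (m : Multiset (AssignedGraph c ρ)) : HopfAlg K c ρ :=
  (m.map MvPolynomial.X).prod

/-- The coproduct, the algebra morphism with
`Δ(G) = G ⊗ 1 + 1 ⊗ G + ∑ g ⊗ G / g` for every assigned graph `G`. -/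
noncomputable def coproduct : HopfAlg K c ρ →ₐ[K] HopfAlg K c ρ ⊗[K] HopfAlg K c ρ :=
  MvPolynomial.aeval fun Γ =>
    MvPolynomial.X Γ ⊗ₜ[K] 1 + 1 ⊗ₜ[K] MvPolynomial.X Γ +
      (Γ.extractions.map fun p => union K c ρ p.1 ⊗ₜ[K] MvPolynomial.X p.2).sum

/-- The counit: `1` on the empty graph and `0` on all other graphs. -/
noncomputable def counit : HopfAlg K c ρ →ₐ[K] K :=
  MvPolynomial.aeval fun _ => 0

/-- The recursion `S(G) = - G - ∑ S(g) (G / g)`, unfolded `n` times. -/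
noncomputable def antipodeAux : ℕ → AssignedGraph c ρ → HopfAlg K c ρ
  | 0, _ => 0
  | n + 1, Γ => - MvPolynomial.X Γ -
      (Γ.extractions.map fun p => (p.1.map (antipodeAux n)).prod * MvPolynomial.X p.2).sum

/-- The antipode, multiplicative and given recursively on assigned graphs. The subgraphs `g` have
fewer edges than `G`, so that as many unfoldings as `G` has edges suffice. -/
noncomputable def antipode : HopfAlg K c ρ →ₐ[K] HopfAlg K c ρ :=
  MvPolynomial.aeval fun Γ => antipodeAux K c ρ Γ.numEdges Γ

end Operations

/-! ### Hopf algebras -/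

/-- The linear maps `Δ`, `ε`, `S` turn the algebra `A` into a Hopf algebra. -/
structure IsHopfAlgebra {K A : Type*} [Field K] [Ring A] [Algebra K A]
    (Δ : A →ₗ[K] A ⊗[K] A) (ε : A →ₗ[K] K) (S : A →ₗ[K] A) : Prop where
  coassoc : TensorProduct.assoc K A A A ∘ₗ Δ.rTensor A ∘ₗ Δ = Δ.lTensor A ∘ₗ Δ
  counit_left : ∀ x, TensorProduct.lid K A (ε.rTensor A (Δ x)) = x
  counit_right : ∀ x, TensorProduct.rid K A (ε.lTensor A (Δ x)) = x
  comul_one : Δ 1 = 1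
  comul_mul : ∀ x y, Δ (x * y) = Δ x * Δ y
  counit_one : ε 1 = 1
  counit_mul : ∀ x y, ε (x * y) = ε x * ε y
  antipode_left : ∀ x, LinearMap.mul' K A (S.rTensor A (Δ x)) = algebraMap K A (ε x)
  antipode_right : ∀ x, LinearMap.mul' K A (S.lTensor A (Δ x)) = algebraMap K A (ε x)

/-- The corresponding Hopf algebra in the sense of the library. -/
@[reducible] noncomputable def IsHopfAlgebra.toHopfAlgebra {K A : Type*} [Field K] [Ring A]
    [Algebra K A] {Δ : A →ₗ[K] A ⊗[K] A} {ε : A →ₗ[K] K} {S : A →ₗ[K] A}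
    (h : IsHopfAlgebra Δ ε S) : HopfAlgebra K A :=
  letI : Coalgebra K A :=
    { comul := Δ
      counit := ε
      coassoc := h.coassoc
      rTensor_counit_comp_comul := LinearMap.ext fun x =>
        (TensorProduct.lid K A).injective (by simp [h.counit_left])
      lTensor_counit_comp_comul := LinearMap.ext fun x =>
        (TensorProduct.rid K A).injective (by simp [h.counit_right]) }
  letI : Bialgebra K A := Bialgebra.mk' K A h.counit_one (h.counit_mul _ _) h.comul_one
    (h.comul_mul _ _)
  { antipode := S
    mul_antipode_rTensor_comul := LinearMap.ext h.antipode_left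
    mul_antipode_lTensor_comul := LinearMap.ext h.antipode_right }

/-- The subspaces `B n` form a grading of `A` as an algebra and coalgebra which is connected, that
is, whose part of degree zero consists of the multiples of the unit. -/
structure IsConnectedGrading {K A : Type*} [Field K] [Ring A] [Algebra K A]
    (Δ : A →ₗ[K] A ⊗[K] A) (B : ℕ → Submodule K A) : Prop where
  isInternal : DirectSum.IsInternal B
  mul_mem : ∀ m n, ∀ x ∈ B m, ∀ y ∈ B n, x * y ∈ B (m + n)
  comul_mem : ∀ n, ∀ x ∈ B n, Δ x ∈ ⨆ p ∈ Finset.HasAntidiagonal.antidiagonal n,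
    LinearMap.range (TensorProduct.map (B p.1).subtype (B p.2).subtype)
  connected : B 0 = LinearMap.range (Algebra.linearMap K A)

end AssignedGraphs

/-! ### Isomorphisms, linkage inside subgraphs, contraction of forests -/

namespace AssignedGraphs

namespace ScaledGraph

variable {c : LegConvention} {ρ : ℕ} {G : ScaledGraph}

/-! ### Isomorphisms from bijections of half-edges -/

/-! Coassociativity is a double count of nested pairs of forests, a forest being a set of pairwise
disjoint connected high 1PI subgraphs with two or four legs. If the empty forest is admitted,
contributing `1 ⊗ G`, then Δ(G) is `G ⊗ 1` plus the sum of `F ⊗ G/F` over the forests F which do not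
exhaust the internal edges (`coproduct_X_mk`). Applying Δ to F and multiplying out selects inside
each γ ∈ F either a proper forest of γ or γ itself, that is, a forest D refining F; the result is
the sum of `D ⊗ F/D ⊗ G/F`, where γ/γ is read as 1 (`coproduct_forestUnion`). Applying Δ to the
cographs instead selects D first and then a forest E of G/D. For fixed D, the proper forests F
refined by D correspond to the proper forests E of G/D, with F/D = E and G/F = (G/D)/E
(`liftForest_pushForest`, `prod_relCograph_liftForest`, `cographOf_liftForest`). Hence the two sums
agree (`sum_coproduct_forestUnion`).

The correspondence rests on two transfer principles, and it is here that highness matters. First, a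
subgraph δ of a high subgraph γ is high in γ if and only if it is high in G
(`Subgraph.isHighDivergent_incl_iff`): a leg of δ is either an edge of γ, which keeps its scale, or
a leg of γ, which lies below every edge of γ anyway, whether or not its scale is forgotten. Second,
the high subgraphs η of G/D are the contractions of those high γ ∉ D in G which contain or avoid
each member of D (`isHighDivergent_liftSubgraph`, `exists_liftHigh_eq`). The legs of η and γ are the
same; a member δ of D reinserted at a vertex of η has an edge of η among its legs, so that scales
decrease from δ through η to the legs. Being 1PI survives contraction, and also the reinsertion of
1PI pieces.

The recursion for S says that S ∗ id = u ∘ ε for the convolution product. Associativity of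
convolution then gives S ∗ (id ∗ S) = S, from which id ∗ S = u ∘ ε follows by induction on the
number of edges. As for the gradings, every internal edge lies either in exactly one extracted
component or in the cograph, while the vertices of each component are replaced by a single one; so
both E and the loop number E - V + 1 are additive. Absence of bridges forces V ≤ E, so both weights
are positive on generators and degree zero consists of constants. -/

theorem IsAssigned.vert_surjective (hG : G.IsAssigned c ρ) : Function.Surjective G.vert := by
  intro v
  have hpos : 0 < Nat.card {h // G.vert h = v} := by
    rcases hG.valence v with h | h <;> omega
  obtain ⟨h, hh⟩ := (Nat.card_pos_iff.1 hpos).1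
  exact ⟨h, hh⟩

theorem Subgraph.toGraph_vert_surjective (c : LegConvention) (γ : G.Subgraph) :
    Function.Surjective (γ.toGraph c).vert := by
  rintro ⟨v, h, hh, rfl⟩
  exact ⟨⟨h, h, hh, rfl⟩, rfl⟩

/-- A bijection of half-edges compatible with the incidence relation, the pairing and the scales
is an isomorphism, if no vertex is isolated. -/
noncomputable def Iso.ofHalfEdges {G G' : ScaledGraph} (hG : Function.Surjective G.vert)
    (hG' : Function.Surjective G'.vert) (e : G.H ≃ G'.H)
    (hv : ∀ h h', G.vert h = G.vert h' ↔ G'.vert (e h) = G'.vert (e h'))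
    (hi : ∀ h, G'.inv (e h) = e (G.inv h)) (hs : ∀ h, G'.scale (e h) = G.scale h) :
    G.Iso G' where
  -- A vertex goes to the end point of the image of any half-edge attached to it; `hv` makes the
  -- choice irrelevant and the map injective.
  onV := Equiv.ofBijective (fun v => G'.vert (e (Function.surjInv hG v))) (by
    constructor
    · intro v w h
      have := (hv _ _).2 h
      rwa [Function.surjInv_eq hG v, Function.surjInv_eq hG w] at this
    · intro w
      obtain ⟨h, rfl⟩ := hG' w
      refine ⟨G.vert (e.symm h), ?_⟩
      have := (hv (Function.surjInv hG (G.vert (e.symm h))) (e.symm h)).1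
        (Function.surjInv_eq _ _)
      simpa using this)
  onH := e
  vert h := ((hv _ _).1 (Function.surjInv_eq hG _)).symm
  inv := hi
  scale := hs

theorem IsAssigned.of_iso {G' : ScaledGraph} (e : G.Iso G') (hG : G.IsAssigned c ρ) :
    G'.IsAssigned c ρ where
  valence v := by
    obtain ⟨v, rfl⟩ := e.onV.surjective v
    have f : {h // G.vert h = v} ≃ {h // G'.vert h = e.onV v} :=
      e.onH.subtypeEquiv fun h => by rw [e.vert, e.onV.apply_eq_iff_eq]
    rw [← Nat.card_congr f]
    exact hG.valence v
  onePI := e.isOnePI hG.onePI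
  scale_le h := by
    obtain ⟨h, rfl⟩ := e.onH.surjective h
    rw [e.scale]; exact hG.scale_le h
  internal_scale h hh := by
    obtain ⟨h, rfl⟩ := e.onH.surjective h
    rw [e.scale]; exact hG.internal_scale h ((e.mem_internal h).1 hh)
  external_scale h hh := by
    obtain ⟨h, rfl⟩ := e.onH.surjective h
    rw [e.scale]
    refine hG.external_scale h ?_
    have : G'.inv (e.onH h) = e.onH h := hh
    rw [e.inv] at this
    exact e.onH.injective this

/-! ### Connectedness of subgraphs -/

theorem Linked.mono {s t : Set G.H} (hst : s ⊆ t) {v w : G.V} (h : G.Linked s v w) :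
    G.Linked t v w :=
  Relation.EqvGen.mono (fun _ _ ⟨h, hs, h1, h2⟩ => ⟨h, hst hs, h1, h2⟩) _ _ h

namespace Subgraph

theorem mem_support_of_mem (γ : G.Subgraph) {h : G.H} (hh : h ∈ γ.carrier) :
    G.vert h ∈ γ.support :=
  ⟨h, hh, rfl⟩

theorem mem_internal_toGraph (γ : G.Subgraph) (h : (γ.toGraph c).H) :
    h ∈ (γ.toGraph c).internal ↔ h.1 ∈ γ.carrier := by
  constructor
  · intro hh
    by_contra hn
    exact hh (γ.toGraph_inv_neg c hn)
  · intro hh h1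
    have h2 := γ.toGraph_inv_pos c hh
    rw [h1] at h2
    exact γ.subset_internal hh h2.symm

theorem linked_of_toGraph (γ : G.Subgraph) {s : Set (γ.toGraph c).H} {t : Set G.H}
    (hs : ∀ h ∈ s, h.1 ∈ γ.carrier ∧ h.1 ∈ t) {v w : (γ.toGraph c).V}
    (h : (γ.toGraph c).Linked s v w) : G.Linked t v.1 w.1 := by
  induction h with
  | rel x y h =>
    obtain ⟨h, hh, rfl, rfl⟩ := h
    refine .rel _ _ ⟨h.1, (hs h hh).2, rfl, ?_⟩
    rw [← γ.toGraph_inv_pos c (hs h hh).1]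
    rfl
  | refl x => exact .refl _
  | symm x y _ ih => exact .symm _ _ ih
  | trans x y z _ _ ih1 ih2 => exact .trans _ _ _ ih1 ih2

/-- Linkage is reflexive at all vertices of `G`, also those outside `γ`; hence the alternative `v =
w`. -/
theorem toGraph_linked (γ : G.Subgraph) {s : Set G.H} {t : Set (γ.toGraph c).H}
    (hs : s ⊆ γ.carrier) (hst : ∀ h : (γ.toGraph c).H, h.1 ∈ s → h ∈ t) {v w : G.V}
    (h : G.Linked s v w) :
    v = w ∨ ∃ (hv : v ∈ γ.support) (hw : w ∈ γ.support),
      (γ.toGraph c).Linked t ⟨v, hv⟩ ⟨w, hw⟩ := by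
  induction h with
  | rel x y h =>
    obtain ⟨h, hh, rfl, rfl⟩ := h
    have hc := hs hh
    refine Or.inr ⟨γ.mem_support_of_mem hc, γ.mem_support_of_mem (γ.inv_mem _ hc), ?_⟩
    refine .rel _ _ ⟨⟨h, γ.mem_support_of_mem hc⟩, hst _ hh, rfl, Subtype.ext ?_⟩
    exact congrArg G.vert (γ.toGraph_inv_pos c (h := ⟨h, γ.mem_support_of_mem hc⟩) hc)
  | refl x => exact Or.inl rfl
  | symm x y _ ih =>
    rcases ih with h | ⟨h1, h2, h3⟩
    · exact Or.inl h.symm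
    · exact Or.inr ⟨h2, h1, .symm _ _ h3⟩
  | trans x y z _ _ ih1 ih2 =>
    rcases ih1 with rfl | ⟨h1, h2, h3⟩
    · exact ih2
    · rcases ih2 with rfl | ⟨h4, h5, h6⟩
      · exact Or.inr ⟨h1, h2, h3⟩
      · exact Or.inr ⟨h1, h5, .trans _ _ _ h3 h6⟩

/-- A subgraph is 1PI if and only if its vertices are linked within the ambient graph by its
edges, even if one of them is omitted. -/
theorem isOnePI_toGraph_iff (c : LegConvention) (γ : G.Subgraph) :
    (γ.toGraph c).IsOnePI ↔ γ.carrier.Nonempty ∧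
      (∀ v ∈ γ.support, ∀ w ∈ γ.support, G.Linked γ.carrier v w) ∧
      ∀ e ∈ γ.carrier, ∀ v ∈ γ.support, ∀ w ∈ γ.support,
        G.Linked (γ.carrier \ {e, G.inv e}) v w := by
  constructor
  · intro h
    refine ⟨?_, fun v hv w hw => ?_, fun e he v hv w hw => ?_⟩
    · obtain ⟨x, hx⟩ := h.nonempty
      exact ⟨x.1, (γ.mem_internal_toGraph x).1 hx⟩
    · exact γ.linked_of_toGraph (fun x hx => ⟨(γ.mem_internal_toGraph x).1 hx,
        (γ.mem_internal_toGraph x).1 hx⟩) (h.connected ⟨v, hv⟩ ⟨w, hw⟩)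
    · let e' : (γ.toGraph c).H := ⟨e, γ.mem_support_of_mem he⟩
      refine γ.linked_of_toGraph (fun x hx => ?_)
        (h.bridgeless e' ((γ.mem_internal_toGraph e').2 he) ⟨v, hv⟩ ⟨w, hw⟩)
      have h1 := (γ.mem_internal_toGraph x).1 hx.1
      refine ⟨h1, h1, ?_⟩
      rintro (h2 | h2)
      · exact hx.2 (Or.inl (Subtype.ext h2))
      · exact hx.2 (Or.inr (Subtype.ext (h2.trans (γ.toGraph_inv_pos c (h := e') he).symm)))
  · rintro ⟨⟨x, hx⟩, h1, h2⟩
    refine ⟨⟨⟨x, γ.mem_support_of_mem hx⟩, (γ.mem_internal_toGraph _).2 hx⟩, ?_, ?_⟩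
    · intro v w
      rcases γ.toGraph_linked (t := (γ.toGraph c).internal) subset_rfl
        (fun h hh => (γ.mem_internal_toGraph h).2 hh) (h1 v.1 v.2 w.1 w.2) with h | ⟨_, _, h⟩
      · rw [Subtype.ext h]; exact .refl _
      · exact h
    · intro e he v w
      have he' := (γ.mem_internal_toGraph e).1 he
      have hst : ∀ h : (γ.toGraph c).H, h.1 ∈ γ.carrier \ {e.1, G.inv e.1} →
          h ∈ (γ.toGraph c).internal \ {e, (γ.toGraph c).inv e} := by
        refine fun h hh => ⟨(γ.mem_internal_toGraph h).2 hh.1, ?_⟩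
        rintro (h3 | h3)
        · exact hh.2 (Or.inl (congrArg Subtype.val h3))
        · exact hh.2 (Or.inr ((congrArg Subtype.val h3).trans (γ.toGraph_inv_pos c he')))
      rcases γ.toGraph_linked Set.sdiff_subset hst (h2 e.1 he' v.1 v.2 w.1 w.2) with
        h | ⟨_, _, h⟩
      · rw [Subtype.ext h]; exact .refl _
      · exact h

/-- A proper subgraph of a connected subgraph has a leg in the latter. -/
theorem exists_leg_mem {γ δ : G.Subgraph} (hδγ : δ.carrier ⊆ γ.carrier)
    (hγ : ∀ v ∈ γ.support, ∀ w ∈ γ.support, G.Linked γ.carrier v w) (hδ : δ.carrier.Nonempty)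
    (hne : ¬ γ.carrier ⊆ δ.carrier) :
    ∃ k ∈ γ.carrier, k ∉ δ.carrier ∧ G.vert k ∈ δ.support := by
  by_contra hcon
  push Not at hcon
  have hk : ∀ k ∈ γ.carrier, G.vert k ∈ δ.support → k ∈ δ.carrier := fun k hk hv => by
    by_contra h
    exact hcon k hk h hv
  -- If no edge of `γ` leaves `δ`, the vertex set of `δ` is closed under linkage by edges of `γ`,
  -- hence contains all vertices of `γ`.
  have key : ∀ v w, G.Linked γ.carrier v w → (v ∈ δ.support ↔ w ∈ δ.support) := by
    intro v w h
    induction h with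
    | rel x y h =>
      obtain ⟨h, hh, rfl, rfl⟩ := h
      refine ⟨fun h1 => δ.mem_support_of_mem (δ.inv_mem _ (hk _ hh h1)), fun h1 => ?_⟩
      exact δ.mem_support_of_mem ((δ.inv_mem_iff _).1 (hk _ (γ.inv_mem _ hh) h1))
    | refl x => exact Iff.rfl
    | symm x y _ ih => exact ih.symm
    | trans x y z _ _ ih1 ih2 => exact ih1.trans ih2
  obtain ⟨x, hx⟩ := hδ
  refine hne fun k hk' => hk k hk' ?_
  exact (key _ _ (hγ _ (γ.mem_support_of_mem (hδγ hx)) _ (γ.mem_support_of_mem hk'))).1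
    (δ.mem_support_of_mem hx)

theorem support_mono {γ δ : G.Subgraph} (h : δ.carrier ⊆ γ.carrier) : δ.support ⊆ γ.support :=
  Set.image_mono h

theorem not_mem_of_disjoint {γ δ : G.Subgraph} (h : Disjoint γ.support δ.support) {k : G.H}
    (hk : G.vert k ∈ γ.support) : k ∉ δ.carrier :=
  fun hk' => Set.disjoint_left.1 h hk (δ.mem_support_of_mem hk')

end Subgraph

namespace HighSubgraph

theorem nonempty (γ : G.HighSubgraph c) : γ.1.carrier.Nonempty :=
  ((γ.1.isOnePI_toGraph_iff c).1 γ.2.onePI).1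

theorem linked (γ : G.HighSubgraph c) :
    ∀ v ∈ γ.1.support, ∀ w ∈ γ.1.support, G.Linked γ.1.carrier v w :=
  ((γ.1.isOnePI_toGraph_iff c).1 γ.2.onePI).2.1

theorem linked_diff (γ : G.HighSubgraph c) : ∀ e ∈ γ.1.carrier,
    ∀ v ∈ γ.1.support, ∀ w ∈ γ.1.support, G.Linked (γ.1.carrier \ {e, G.inv e}) v w :=
  ((γ.1.isOnePI_toGraph_iff c).1 γ.2.onePI).2.2

theorem ext_carrier {γ δ : G.HighSubgraph c} (h : γ.1.carrier = δ.1.carrier) : γ = δ :=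
  Subtype.ext (Subgraph.ext h)

theorem not_disjoint_self (γ : G.HighSubgraph c) : ¬ Disjoint γ.1.support γ.1.support := by
  obtain ⟨x, hx⟩ := γ.nonempty
  exact fun h => Set.disjoint_left.1 h (γ.1.mem_support_of_mem hx) (γ.1.mem_support_of_mem hx)

/-- Two or four legs are at least one. The leg keeps the vertex to which `γ` is contracted from
being isolated. -/
theorem exists_leg (γ : G.HighSubgraph c) : ∃ k, G.vert k ∈ γ.1.support ∧ k ∉ γ.1.carrier := by
  have hpos : 0 < Nat.card γ.1.legs := by rcases γ.2.points with h | h <;> omega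
  obtain ⟨k, hk⟩ := (Nat.card_pos_iff.1 hpos).1
  exact ⟨k, hk⟩

end HighSubgraph

/-! ### Forests: families of disjoint high subgraphs -/

/-- The members of `F` are pairwise disjoint. -/
def IsForest (F : Finset (G.HighSubgraph c)) : Prop :=
  ∀ γ ∈ F, ∀ γ' ∈ F, γ ≠ γ' → Disjoint γ.1.support γ'.1.support

/-- The members of `F` are pairwise disjoint and do not exhaust the internal edges. -/
structure IsProperForest (F : Finset (G.HighSubgraph c)) : Prop where
  forest : IsForest F
  proper : ∃ h ∈ G.internal, ∀ γ ∈ F, h ∉ γ.1.carrier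

theorem IsExtraction.isProperForest {F : Finset (G.HighSubgraph c)} (hF : IsExtraction c F) :
    IsProperForest F :=
  ⟨hF.disjoint, hF.proper⟩

theorem IsProperForest.isExtraction {F : Finset (G.HighSubgraph c)} (hF : IsProperForest F)
    (hne : F.Nonempty) : IsExtraction c F :=
  ⟨hne, hF.forest, hF.proper⟩

theorem isForest_empty : IsForest (∅ : Finset (G.HighSubgraph c)) :=
  fun _ h => absurd h (Finset.notMem_empty _)

theorem IsForest.mono {F F' : Finset (G.HighSubgraph c)} (hF : IsForest F) (h : F' ⊆ F) :
    IsForest F' :=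
  fun γ hγ γ' hγ' => hF γ (h hγ) γ' (h hγ')

theorem IsForest.eq_of_mem {F : Finset (G.HighSubgraph c)} (hF : IsForest F)
    {γ γ' : G.HighSubgraph c} (hγ : γ ∈ F) (hγ' : γ' ∈ F) {v : G.V} (hv : v ∈ γ.1.support)
    (hv' : v ∈ γ'.1.support) : γ = γ' := by
  by_contra h
  exact Set.disjoint_left.1 (hF γ hγ γ' hγ' h) hv hv'

/-- Two members of a forest sharing a vertex coincide, so the generating relation, with equality
adjoined, is already transitive. The empty forest and forests exhausting all edges are covered too.
-/
theorem IsForest.mk_eq_iff {F : Finset (G.HighSubgraph c)} (hF : IsForest F) (v w : G.V) :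
    ((Quot.mk _ v : (G.shrink c F).V) = Quot.mk _ w) ↔
      v = w ∨ ∃ γ ∈ F, v ∈ γ.1.support ∧ w ∈ γ.1.support := by
  refine ⟨fun h => ?_, ?_⟩
  · have h' := Quot.eqvGen_exact h
    clear h
    induction h' with
    | rel _ _ hr => exact Or.inr hr
    | refl _ => exact Or.inl rfl
    | symm _ _ _ ih =>
      rcases ih with rfl | ⟨γ, hγ, h1, h2⟩
      · exact Or.inl rfl
      · exact Or.inr ⟨γ, hγ, h2, h1⟩
    | trans _ _ _ _ _ ih1 ih2 =>
      rcases ih1 with rfl | ⟨γ, hγ, h1, h2⟩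
      · exact ih2
      · rcases ih2 with rfl | ⟨γ', hγ', h3, h4⟩
        · exact Or.inr ⟨γ, hγ, h1, h2⟩
        · obtain rfl := hF.eq_of_mem hγ hγ' h2 h3
          exact Or.inr ⟨γ, hγ, h1, h4⟩
  · rintro (rfl | h)
    · rfl
    · exact Quot.sound h

/-- A vertex of the cograph which comes from a member of the forest. -/
theorem IsForest.mem_support_of_mk_eq {F : Finset (G.HighSubgraph c)} (hF : IsForest F)
    {γ : G.HighSubgraph c} (hγ : γ ∈ F) {v w : G.V} (hv : v ∈ γ.1.support)
    (h : (Quot.mk _ v : (G.shrink c F).V) = Quot.mk _ w) : w ∈ γ.1.support := by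
  rcases (hF.mk_eq_iff v w).1 h with rfl | ⟨γ', hγ', h1, h2⟩
  · exact hv
  · rwa [hF.eq_of_mem hγ hγ' hv h1]

/-- A contracted member leaves its legs at the new vertex, and half-edges at any other vertex
survive. This is the hypothesis of `Iso.ofHalfEdges` for cographs. -/
theorem IsForest.shrink_vert_surjective {F : Finset (G.HighSubgraph c)} (hF : IsForest F)
    (hG : Function.Surjective G.vert) : Function.Surjective (G.shrink c F).vert := by
  intro v
  obtain ⟨v, rfl⟩ := Quot.exists_rep v
  by_cases hv : ∃ γ ∈ F, v ∈ γ.1.support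
  · obtain ⟨γ, hγ, hv⟩ := hv
    obtain ⟨k, hk, hk'⟩ := γ.exists_leg
    refine ⟨⟨k, fun γ' hγ' hm => ?_⟩, (hF.mk_eq_iff _ _).2 (Or.inr ⟨γ, hγ, hk, hv⟩)⟩
    obtain rfl := hF.eq_of_mem hγ hγ' hk (γ'.1.mem_support_of_mem hm)
    exact hk' hm
  · push Not at hv
    obtain ⟨h, rfl⟩ := hG v
    exact ⟨⟨h, fun γ hγ hm => hv γ hγ (γ.1.mem_support_of_mem hm)⟩, rfl⟩

/-- Shrinking nothing. -/
noncomputable def shrinkEmpty (c : LegConvention) (G : ScaledGraph) :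
    G.Iso (G.shrink c ∅) where
  onV := Equiv.ofBijective (Quot.mk _) ⟨fun v w h => by
      simpa using (isForest_empty.mk_eq_iff v w).1 h, Quot.mk_surjective⟩
  onH := (Equiv.subtypeUnivEquiv fun _ _ h => absurd h (Finset.notMem_empty _)).symm
  vert _ := rfl
  inv _ := rfl
  scale _ := rfl

theorem IsProperForest.isOnePI_shrink {F : Finset (G.HighSubgraph c)} (hF : IsProperForest F)
    (hG : G.IsOnePI) : (G.shrink c F).IsOnePI where
  nonempty := by
    obtain ⟨h, hi, hh⟩ := hF.proper
    exact ⟨⟨h, hh⟩, fun h' => hi (congrArg Subtype.val h')⟩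
  connected v w := by
    obtain ⟨v, rfl⟩ := Quot.exists_rep v
    obtain ⟨w, rfl⟩ := Quot.exists_rep w
    refine shrink_linked (s := G.internal) ?_ (hG.connected v w)
    exact fun h hh hi h' => hi (congrArg Subtype.val h')
  bridgeless e he v w := by
    obtain ⟨v, rfl⟩ := Quot.exists_rep v
    obtain ⟨w, rfl⟩ := Quot.exists_rep w
    refine shrink_linked (s := G.internal \ {e.1, G.inv e.1}) ?_
      (hG.bridgeless e.1 (fun h' => he (Subtype.ext h')) v w)
    rintro h hh ⟨hi, hn⟩
    refine ⟨fun h' => hi (congrArg Subtype.val h'), ?_⟩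
    rintro (h' | h')
    · exact hn (Or.inl (congrArg Subtype.val h'))
    · exact hn (Or.inr (congrArg Subtype.val h'))

theorem IsProperForest.shrink_isAssigned {F : Finset (G.HighSubgraph c)} (hF : IsProperForest F)
    (hG : G.IsAssigned c ρ) : (G.shrink c F).IsAssigned c ρ := by
  rcases F.eq_empty_or_nonempty with rfl | hne
  · exact hG.of_iso (shrinkEmpty c G)
  · exact ScaledGraph.shrink_isAssigned hG ⟨F, hF.isExtraction hne⟩

end ScaledGraph

end AssignedGraphs

/-! ### First transfer principle: from a high subgraph to the ambient graph -/

namespace AssignedGraphs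

/-- This makes a subgraph of a subgraph carry the same leg scales as when it is taken directly in
`G`. -/
theorem LegConvention.leg_leg (c : LegConvention) (s : WithBot ℕ) : c.leg (c.leg s) = c.leg s := by
  cases c <;> rfl

theorem LegConvention.leg_le (c : LegConvention) (s : WithBot ℕ) : c.leg s ≤ s := by
  cases c
  · exact bot_le
  · exact le_rfl

namespace ScaledGraph

variable {c : LegConvention} {ρ : ℕ} {G : ScaledGraph}

/-! ### Subgraphs of subgraphs -/

namespace Subgraph

/-- A subgraph of a subgraph, as a subgraph of the ambient graph. -/
def incl (γ : G.Subgraph) (δ : (γ.toGraph c).Subgraph) : G.Subgraph where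
  carrier := {h | ∃ hh : G.vert h ∈ γ.support, (⟨h, hh⟩ : (γ.toGraph c).H) ∈ δ.carrier}
  inv_mem := by
    rintro h ⟨hh, hm⟩
    have hc := (γ.mem_internal_toGraph _).1 (δ.subset_internal hm)
    have h1 := γ.toGraph_inv_pos c hc
    have h2 := δ.inv_mem _ hm
    have h3 : G.vert (G.inv h) ∈ γ.support := γ.mem_support_of_mem (γ.inv_mem _ hc)
    have h4 : (γ.toGraph c).inv ⟨h, hh⟩ = ⟨G.inv h, h3⟩ := Subtype.ext h1
    exact ⟨h3, h4 ▸ h2⟩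
  subset_internal := by
    rintro h ⟨hh, hm⟩
    exact γ.subset_internal ((γ.mem_internal_toGraph _).1 (δ.subset_internal hm))

/-- A subgraph contained in another one, as a subgraph of the latter. -/
def restr (c : LegConvention) (γ δ : G.Subgraph) (hδ : δ.carrier ⊆ γ.carrier) :
    (γ.toGraph c).Subgraph where
  carrier := {h | h.1 ∈ δ.carrier}
  inv_mem h hh := by
    change ((γ.toGraph c).inv h).1 ∈ δ.carrier
    rw [γ.toGraph_inv_pos c (hδ hh)]
    exact δ.inv_mem _ hh
  subset_internal h hh := (γ.mem_internal_toGraph h).2 (hδ hh)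

theorem mem_incl (γ : G.Subgraph) (δ : (γ.toGraph c).Subgraph) (h : (γ.toGraph c).H) :
    h.1 ∈ (γ.incl δ).carrier ↔ h ∈ δ.carrier :=
  ⟨fun ⟨_, hm⟩ => hm, fun hm => ⟨h.2, hm⟩⟩

theorem incl_subset (γ : G.Subgraph) (δ : (γ.toGraph c).Subgraph) :
    (γ.incl δ).carrier ⊆ γ.carrier := by
  rintro h ⟨hh, hm⟩
  exact (γ.mem_internal_toGraph _).1 (δ.subset_internal hm)

theorem mem_support_incl (γ : G.Subgraph) (δ : (γ.toGraph c).Subgraph) (v : (γ.toGraph c).V) :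
    v.1 ∈ (γ.incl δ).support ↔ v ∈ δ.support := by
  constructor
  · rintro ⟨h, ⟨hh, hm⟩, hv⟩
    exact ⟨⟨h, hh⟩, hm, Subtype.ext hv⟩
  · rintro ⟨h, hm, rfl⟩
    exact ⟨h.1, ⟨h.2, hm⟩, rfl⟩

theorem incl_restr (γ δ : G.Subgraph) (hδ : δ.carrier ⊆ γ.carrier) :
    γ.incl (restr c γ δ hδ) = δ := by
  ext h
  exact ⟨fun ⟨_, hm⟩ => hm, fun hm => ⟨γ.mem_support_of_mem (hδ hm), hm⟩⟩

theorem incl_injective (c : LegConvention) (γ : G.Subgraph) :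
    Function.Injective (γ.incl (c := c)) := by
  intro δ δ' h
  ext x
  rw [← γ.mem_incl δ, h, γ.mem_incl]

theorem mem_legs_incl (γ : G.Subgraph) (δ : (γ.toGraph c).Subgraph) (h : (γ.toGraph c).H) :
    h.1 ∈ (γ.incl δ).legs ↔ h ∈ δ.legs :=
  and_congr (γ.mem_support_incl δ ((γ.toGraph c).vert h)) (not_congr (γ.mem_incl δ h))

theorem vert_mem_of_mem_support_incl (γ : G.Subgraph) (δ : (γ.toGraph c).Subgraph) {v : G.V}
    (hv : v ∈ (γ.incl δ).support) : v ∈ γ.support :=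
  support_mono (γ.incl_subset δ) hv

/-- A subgraph of a subgraph is the same graph as the corresponding subgraph of the
ambient graph. -/
noncomputable def inclIso (γ : G.Subgraph) (δ : (γ.toGraph c).Subgraph) :
    (δ.toGraph c).Iso ((γ.incl δ).toGraph c) :=
  Iso.ofHalfEdges (toGraph_vert_surjective c _) (toGraph_vert_surjective c _)
    { toFun := fun h => ⟨h.1.1, (γ.mem_support_incl δ _).2 h.2⟩
      invFun := fun h => ⟨⟨h.1, γ.vert_mem_of_mem_support_incl δ h.2⟩,
        (γ.mem_support_incl δ ⟨_, γ.vert_mem_of_mem_support_incl δ h.2⟩).1 h.2⟩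
      left_inv := fun _ => rfl
      right_inv := fun _ => rfl }
    (fun h h' => by
      constructor
      · exact fun h1 => Subtype.ext (congrArg (fun x => x.1.1) h1)
      · intro h1
        have h2 : G.vert h.1.1 = G.vert h'.1.1 := congrArg Subtype.val h1
        exact Subtype.ext (Subtype.ext h2))
    (fun h => by
      apply Subtype.ext
      by_cases hh : h.1 ∈ δ.carrier
      · have h1 := (γ.mem_incl δ h.1).2 hh
        refine (toGraph_inv_pos c (γ.incl δ) h1).trans ?_
        refine (γ.toGraph_inv_pos c (γ.incl_subset δ h1)).symm.trans ?_
        exact congrArg Subtype.val (toGraph_inv_pos c δ hh).symm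
      · have h1 := mt (γ.mem_incl δ h.1).1 hh
        rw [toGraph_inv_neg c δ hh]
        exact congrArg Subtype.val (toGraph_inv_neg c (γ.incl δ) h1))
    (fun h => by
      by_cases hh : h.1 ∈ δ.carrier
      · have h1 := (γ.mem_incl δ h.1).2 hh
        rw [toGraph_scale_pos c δ hh]
        refine (toGraph_scale_pos c (γ.incl δ) h1).trans ?_
        exact (γ.toGraph_scale_pos c (γ.incl_subset δ h1)).symm
      · have h1 := mt (γ.mem_incl δ h.1).1 hh
        rw [toGraph_scale_neg c δ hh]
        refine (toGraph_scale_neg c (γ.incl δ) h1).trans ?_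
        by_cases h2 : h.1.1 ∈ γ.carrier
        · rw [γ.toGraph_scale_pos c h2]; rfl
        · rw [γ.toGraph_scale_neg c h2, c.leg_leg]; rfl)

theorem card_legs_incl (γ : G.Subgraph) (δ : (γ.toGraph c).Subgraph) :
    Nat.card (γ.incl δ).legs = Nat.card δ.legs :=
  Nat.card_congr
    { toFun := fun h => ⟨⟨h.1, γ.vert_mem_of_mem_support_incl δ h.2.1⟩,
        (γ.mem_legs_incl δ ⟨_, γ.vert_mem_of_mem_support_incl δ h.2.1⟩).1 h.2⟩
      invFun := fun h => ⟨h.1.1, (γ.mem_legs_incl δ _).2 h.2⟩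
      left_inv := fun _ => rfl
      right_inv := fun _ => rfl }

/-- Highness within a high subgraph is highness within the ambient graph. -/
theorem isHighDivergent_incl_iff (γ : G.HighSubgraph c) (δ : (γ.1.toGraph c).Subgraph) :
    (γ.1.incl δ).IsHighDivergent c ↔ δ.IsHighDivergent c := by
  constructor
  · intro h
    refine ⟨(γ.1.inclIso δ).symm.isOnePI h.onePI, γ.1.card_legs_incl δ ▸ h.points, ?_⟩
    intro x hx l hl
    have hx' := (γ.1.mem_incl δ x).2 hx
    have h1 := h.high x.1 hx' l.1 ((γ.1.mem_legs_incl δ l).2 hl)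
    rw [γ.1.toGraph_scale_pos c (γ.1.incl_subset δ hx')]
    by_cases hl' : l.1 ∈ γ.1.carrier
    · rwa [γ.1.toGraph_scale_pos c hl']
    -- Regarded inside `γ`, this leg has at most the scale which it has in `G`.
    · rw [γ.1.toGraph_scale_neg c hl']
      exact (c.leg_le _).trans_lt h1
  · intro h
    refine ⟨(γ.1.inclIso δ).isOnePI h.onePI, (γ.1.card_legs_incl δ).symm ▸ h.points, ?_⟩
    intro x hx l hl
    have hxγ := γ.1.incl_subset δ hx
    have hlγ := γ.1.vert_mem_of_mem_support_incl δ hl.1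
    by_cases hl' : l ∈ γ.1.carrier
    · have h1 := h.high ⟨x, γ.1.mem_support_of_mem hxγ⟩ ((γ.1.mem_incl δ _).1 hx) ⟨l, hlγ⟩
        ((γ.1.mem_legs_incl δ _).1 hl)
      rwa [γ.1.toGraph_scale_pos c (h := ⟨x, _⟩) hxγ,
        γ.1.toGraph_scale_pos c (h := ⟨l, hlγ⟩) hl'] at h1
    -- A leg of the smaller subgraph which is no edge of `γ` is a leg of `γ`. Its scale may be
    -- forgotten inside `γ`; the bound comes from the highness of `γ` itself.
    · exact γ.2.high x hxγ l ⟨hlγ, hl'⟩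

end Subgraph

namespace HighSubgraph

/-- The high subgraphs of a high subgraph are high subgraphs of the ambient graph. -/
def incl (γ : G.HighSubgraph c) : (γ.1.toGraph c).HighSubgraph c ↪ G.HighSubgraph c where
  toFun δ := ⟨γ.1.incl δ.1, (Subgraph.isHighDivergent_incl_iff γ δ.1).2 δ.2⟩
  inj' _ _ h := Subtype.ext (γ.1.incl_injective c (congrArg Subtype.val h))

theorem incl_subset (γ : G.HighSubgraph c) (δ : (γ.1.toGraph c).HighSubgraph c) :
    (γ.incl δ).1.carrier ⊆ γ.1.carrier :=
  γ.1.incl_subset δ.1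

theorem exists_incl_eq (γ : G.HighSubgraph c) {δ : G.HighSubgraph c}
    (hδ : δ.1.carrier ⊆ γ.1.carrier) : ∃ δ', γ.incl δ' = δ := by
  have h := γ.1.incl_restr (c := c) δ.1 hδ
  exact ⟨⟨Subgraph.restr c γ.1 δ.1 hδ,
    (Subgraph.isHighDivergent_incl_iff γ _).1 (by rw [h]; exact δ.2)⟩, Subtype.ext h⟩

theorem disjoint_incl_iff (γ : G.HighSubgraph c) (δ δ' : (γ.1.toGraph c).HighSubgraph c) :
    Disjoint (γ.incl δ).1.support (γ.incl δ').1.support ↔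
      Disjoint δ.1.support δ'.1.support := by
  simp only [Set.disjoint_left]
  constructor
  · intro h v hv hv'
    exact h ((γ.1.mem_support_incl δ.1 v).2 hv) ((γ.1.mem_support_incl δ'.1 v).2 hv')
  · intro h v hv hv'
    have hγ := γ.1.vert_mem_of_mem_support_incl δ.1 hv
    exact h ((γ.1.mem_support_incl δ.1 ⟨v, hγ⟩).1 hv) ((γ.1.mem_support_incl δ'.1 ⟨v, hγ⟩).1 hv')

/-- The members of `D` contained in `γ`, as subgraphs of `γ`. -/
noncomputable def restrict (γ : G.HighSubgraph c) (D : Finset (G.HighSubgraph c)) :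
    Finset ((γ.1.toGraph c).HighSubgraph c) :=
  D.preimage γ.incl γ.incl.injective.injOn

theorem mem_restrict (γ : G.HighSubgraph c) (D : Finset (G.HighSubgraph c))
    (δ : (γ.1.toGraph c).HighSubgraph c) : δ ∈ γ.restrict D ↔ γ.incl δ ∈ D :=
  Finset.mem_preimage

theorem restrict_map_incl (γ : G.HighSubgraph c)
    (E : Finset ((γ.1.toGraph c).HighSubgraph c)) : γ.restrict (E.map γ.incl) = E := by
  ext δ
  rw [mem_restrict, Finset.mem_map' γ.incl]

theorem map_incl_restrict (γ : G.HighSubgraph c) {D : Finset (G.HighSubgraph c)}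
    (hD : ∀ δ ∈ D, δ.1.carrier ⊆ γ.1.carrier) : (γ.restrict D).map γ.incl = D := by
  ext δ
  rw [Finset.mem_map]
  constructor
  · rintro ⟨δ', h, rfl⟩
    exact (γ.mem_restrict D δ').1 h
  · intro h
    obtain ⟨δ', rfl⟩ := γ.exists_incl_eq (hD _ h)
    exact ⟨δ', (γ.mem_restrict D δ').2 h, rfl⟩

end HighSubgraph

theorem IsForest.restrict {D : Finset (G.HighSubgraph c)} (hD : IsForest D)
    (γ : G.HighSubgraph c) : IsForest (γ.restrict D) :=
  fun δ hδ δ' hδ' hne => (γ.disjoint_incl_iff δ δ').1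
    (hD _ ((γ.mem_restrict D δ).1 hδ) _ ((γ.mem_restrict D δ').1 hδ')
      fun h => hne (γ.incl.injective h))

theorem IsForest.map_incl {γ : G.HighSubgraph c} {E : Finset ((γ.1.toGraph c).HighSubgraph c)}
    (hE : IsForest E) : IsForest (E.map γ.incl) := by
  intro δ hδ δ' hδ' hne
  obtain ⟨δ, h, rfl⟩ := Finset.mem_map.1 hδ
  obtain ⟨δ', h', rfl⟩ := Finset.mem_map.1 hδ'
  exact (γ.disjoint_incl_iff δ δ').2 (hE _ h _ h' fun h => hne (congrArg _ h))

/-- The edges of a high subgraph are not exhausted by those of smaller disjoint ones. -/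
theorem IsForest.exists_mem_carrier {D : Finset (G.HighSubgraph c)} (hD : IsForest D)
    {γ : G.HighSubgraph c} (hγ : γ ∉ D) :
    ∃ h ∈ γ.1.carrier, ∀ δ ∈ D, δ.1.carrier ⊆ γ.1.carrier → h ∉ δ.1.carrier := by
  by_cases hex : ∃ δ ∈ D, δ.1.carrier ⊆ γ.1.carrier
  · obtain ⟨δ, hδ, hsub⟩ := hex
    -- An edge of `γ` leaving `δ` at one of its vertices: it is not in `δ`, nor in another member of
    -- `D`, which would share that vertex with `δ`.
    obtain ⟨k, hk, hkδ, hkv⟩ := Subgraph.exists_leg_mem hsub γ.linked δ.nonempty fun h =>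
      hγ (by rwa [HighSubgraph.ext_carrier (h.antisymm hsub)])
    refine ⟨k, hk, fun δ' hδ' _ hm => ?_⟩
    obtain rfl := hD.eq_of_mem hδ hδ' hkv (δ'.1.mem_support_of_mem hm)
    exact hkδ hm
  · push Not at hex
    obtain ⟨h, hh⟩ := γ.nonempty
    exact ⟨h, hh, fun δ hδ hsub => absurd hsub (hex δ hδ)⟩

/-- A member of `D` exhausts its own edges, whereas disjoint subgraphs strictly inside a connected
one cannot exhaust it. This dichotomy distinguishes the trivial cograph γ/γ from the genuine ones.
-/
theorem IsForest.isProperForest_restrict_iff {D : Finset (G.HighSubgraph c)} (hD : IsForest D)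
    (γ : G.HighSubgraph c) : IsProperForest (γ.restrict D) ↔ γ ∉ D := by
  constructor
  · rintro ⟨_, h, hh, hn⟩ hγ
    obtain ⟨γ', hγ'⟩ := γ.exists_incl_eq (δ := γ) subset_rfl
    refine hn γ' ((γ.mem_restrict D γ').2 (hγ'.symm ▸ hγ)) ?_
    rw [← γ.1.mem_incl γ'.1]
    have : γ.1.incl γ'.1 = γ.1 := congrArg Subtype.val hγ'
    rw [this]
    exact (γ.1.mem_internal_toGraph h).1 hh
  · intro hγ
    obtain ⟨h, hh, hn⟩ := hD.exists_mem_carrier hγ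
    refine ⟨hD.restrict γ, ⟨h, γ.1.mem_support_of_mem hh⟩, (γ.1.mem_internal_toGraph _).2 hh,
      fun δ hδ hm => ?_⟩
    exact hn _ ((γ.mem_restrict D δ).1 hδ) (γ.incl_subset δ) ((γ.1.mem_incl δ.1 _).2 hm)

end ScaledGraph

end AssignedGraphs

/-! ### Second transfer principle: from a cograph to the graph -/

namespace AssignedGraphs

namespace ScaledGraph

variable {c : LegConvention} {ρ : ℕ} {G : ScaledGraph}

/-! ### Subgraphs of cographs -/

/-- The vertex of the cograph which comes from a vertex of the graph. -/
abbrev shrinkMk (D : Finset (G.HighSubgraph c)) (v : G.V) : (G.shrink c D).V := Quot.mk _ v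

/-- Every member of `D` is contained in `γ` or disjoint from it. -/
def IsCompatible (D : Finset (G.HighSubgraph c)) (γ : G.HighSubgraph c) : Prop :=
  ∀ δ ∈ D, δ.1.carrier ⊆ γ.1.carrier ∨ Disjoint δ.1.support γ.1.support

theorem IsCompatible.subset {D : Finset (G.HighSubgraph c)} {γ : G.HighSubgraph c}
    (h : IsCompatible D γ) {δ : G.HighSubgraph c} (hδ : δ ∈ D) {v : G.V} (hv : v ∈ δ.1.support)
    (hv' : v ∈ γ.1.support) : δ.1.carrier ⊆ γ.1.carrier :=
  (h δ hδ).resolve_right fun h => Set.disjoint_left.1 h hv hv'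

/-- A subgraph of the cograph is the cograph of the corresponding subgraph. -/
noncomputable def quotientIso {D : Finset (G.HighSubgraph c)} (hD : IsForest D)
    {γ : G.HighSubgraph c} (hγ : IsCompatible D γ) (η : (G.shrink c D).Subgraph)
    (hc : ∀ h : (G.shrink c D).H, h ∈ η.carrier ↔ h.1 ∈ γ.1.carrier)
    (hs : ∀ v : G.V, shrinkMk D v ∈ η.support ↔ v ∈ γ.1.support) :
    (η.toGraph c).Iso ((γ.1.toGraph c).shrink c (γ.restrict D)) :=
  -- By compatibility, a member of `D` with an edge attached to `γ` is contained in `γ`, so only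
  -- those members need to be tested.
  have aux : ∀ h (hh : G.vert h ∈ γ.1.support),
      (∀ δ ∈ γ.restrict D, (⟨h, hh⟩ : (γ.1.toGraph c).H) ∉ δ.1.carrier) →
        ∀ δ ∈ D, h ∉ δ.1.carrier := by
    intro h hh hn δ hδ hm
    obtain ⟨δ', rfl⟩ := γ.exists_incl_eq (hγ.subset hδ (δ.1.mem_support_of_mem hm) hh)
    exact hn δ' ((γ.mem_restrict D δ').2 hδ) ((γ.1.mem_incl δ'.1 ⟨h, hh⟩).1 hm)
  Iso.ofHalfEdges (Subgraph.toGraph_vert_surjective c _)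
    ((hD.restrict γ).shrink_vert_surjective (Subgraph.toGraph_vert_surjective c _))
    { toFun := fun h => ⟨⟨h.1.1, (hs _).1 h.2⟩, fun δ hδ hm =>
        h.1.2 _ ((γ.mem_restrict D δ).1 hδ) ((γ.1.mem_incl δ.1 _).2 hm)⟩
      invFun := fun h => ⟨⟨h.1.1, aux h.1.1 h.1.2 h.2⟩, (hs _).2 h.1.2⟩
      left_inv := fun _ => rfl
      right_inv := fun _ => rfl }
    (fun h h' => by
      have e1 : (η.toGraph c).vert h = (η.toGraph c).vert h' ↔
          shrinkMk D (G.vert h.1.1) = shrinkMk D (G.vert h'.1.1) := Subtype.ext_iff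
      have h1 := (hs _).1 h.2
      have h1' := (hs _).1 h'.2
      refine e1.trans ((hD.mk_eq_iff _ _).trans
        (Iff.trans ?_ ((hD.restrict γ).mk_eq_iff ⟨_, h1⟩ ⟨_, h1'⟩).symm))
      refine or_congr (Subtype.mk_eq_mk (h := h1) (h' := h1')).symm ?_
      constructor
      · rintro ⟨δ, hδ, h2, h3⟩
        obtain ⟨δ', rfl⟩ := γ.exists_incl_eq (hγ.subset hδ h2 h1)
        exact ⟨δ', (γ.mem_restrict D δ').2 hδ, (γ.1.mem_support_incl δ'.1 ⟨_, h1⟩).1 h2,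
          (γ.1.mem_support_incl δ'.1 ⟨_, h1'⟩).1 h3⟩
      · rintro ⟨δ, hδ, h2, h3⟩
        exact ⟨_, (γ.mem_restrict D δ).1 hδ, (γ.1.mem_support_incl δ.1 ⟨_, h1⟩).2 h2,
          (γ.1.mem_support_incl δ.1 ⟨_, h1'⟩).2 h3⟩)
    (fun h => by
      apply Subtype.ext
      apply Subtype.ext
      have h1 := (hs _).1 h.2
      by_cases hh : h.1 ∈ η.carrier
      · refine (γ.1.toGraph_inv_pos c (h := ⟨h.1.1, h1⟩) ((hc _).1 hh)).trans ?_
        exact congrArg Subtype.val (Subgraph.toGraph_inv_pos c η hh).symm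
      · rw [Subgraph.toGraph_inv_neg c η hh]
        exact congrArg Subtype.val
          (γ.1.toGraph_inv_neg c (h := ⟨h.1.1, h1⟩) (mt (hc _).2 hh)))
    (fun h => by
      have h1 := (hs _).1 h.2
      by_cases hh : h.1 ∈ η.carrier
      · refine (γ.1.toGraph_scale_pos c (h := ⟨h.1.1, h1⟩) ((hc _).1 hh)).trans ?_
        exact (Subgraph.toGraph_scale_pos c η hh).symm
      · refine (γ.1.toGraph_scale_neg c (h := ⟨h.1.1, h1⟩) (mt (hc _).2 hh)).trans ?_
        exact (Subgraph.toGraph_scale_neg c η hh).symm)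

/-- The preimage in `G` of a subgraph of a cograph, including those members of the forest which
have become vertices of the subgraph. -/
def liftSubgraph (D : Finset (G.HighSubgraph c)) (η : (G.shrink c D).Subgraph) : G.Subgraph where
  carrier := {h | (∃ hh : ∀ δ ∈ D, h ∉ δ.1.carrier, (⟨h, hh⟩ : (G.shrink c D).H) ∈ η.carrier) ∨
    ∃ δ ∈ D, h ∈ δ.1.carrier ∧ shrinkMk D (G.vert h) ∈ η.support}
  inv_mem := by
    rintro h (⟨hh, hm⟩ | ⟨δ, hδ, hm, hv⟩)
    · exact Or.inl ⟨_, η.inv_mem _ hm⟩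
    · refine Or.inr ⟨δ, hδ, δ.1.inv_mem _ hm, ?_⟩
      have : shrinkMk D (G.vert (G.inv h)) = shrinkMk D (G.vert h) := Quot.sound
        ⟨δ, hδ, δ.1.mem_support_of_mem (δ.1.inv_mem _ hm), δ.1.mem_support_of_mem hm⟩
      rwa [this]
  subset_internal := by
    rintro h (⟨hh, hm⟩ | ⟨δ, hδ, hm, hv⟩)
    · exact fun h1 => η.subset_internal hm (Subtype.ext h1)
    · exact δ.1.subset_internal hm

theorem mem_liftSubgraph {D : Finset (G.HighSubgraph c)} (η : (G.shrink c D).Subgraph)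
    (h : (G.shrink c D).H) : h.1 ∈ (liftSubgraph D η).carrier ↔ h ∈ η.carrier := by
  constructor
  · rintro (⟨_, hm⟩ | ⟨δ, hδ, hm, _⟩)
    · exact hm
    · exact absurd hm (h.2 δ hδ)
  · exact fun hm => Or.inl ⟨h.2, hm⟩

theorem mem_support_liftSubgraph {D : Finset (G.HighSubgraph c)} (hD : IsForest D)
    (η : (G.shrink c D).Subgraph) (v : G.V) :
    v ∈ (liftSubgraph D η).support ↔ shrinkMk D v ∈ η.support := by
  constructor
  · rintro ⟨h, ⟨_, hm⟩ | ⟨δ, hδ, hm, hv⟩, rfl⟩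
    · exact η.mem_support_of_mem hm
    · exact hv
  · rintro ⟨h, hm, hv⟩
    rcases (hD.mk_eq_iff _ _).1 hv with rfl | ⟨δ, hδ, h1, ⟨k, hk, rfl⟩⟩
    · exact ⟨h.1, (mem_liftSubgraph η h).2 hm, rfl⟩
    · exact ⟨k, Or.inr ⟨δ, hδ, hk, h, hm, hv⟩, rfl⟩

theorem subset_liftSubgraph {D : Finset (G.HighSubgraph c)} (η : (G.shrink c D).Subgraph)
    {δ : G.HighSubgraph c} (hδ : δ ∈ D) {v : G.V} (hv : v ∈ δ.1.support)
    (hv' : shrinkMk D v ∈ η.support) : δ.1.carrier ⊆ (liftSubgraph D η).carrier := by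
  intro h hh
  refine Or.inr ⟨δ, hδ, hh, ?_⟩
  have : shrinkMk D (G.vert h) = shrinkMk D v := Quot.sound
    ⟨δ, hδ, δ.1.mem_support_of_mem hh, hv⟩
  rwa [this]

theorem mem_legs_liftSubgraph {D : Finset (G.HighSubgraph c)} (hD : IsForest D)
    (η : (G.shrink c D).Subgraph) (h : (G.shrink c D).H) :
    h.1 ∈ (liftSubgraph D η).legs ↔ h ∈ η.legs :=
  and_congr (mem_support_liftSubgraph hD η _) (not_congr (mem_liftSubgraph η h))

/-- A member of `D` meeting the lift is contained in it, so that its edges are edges of the lift.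
Consequently contraction neither removes nor adds legs. -/
theorem not_mem_of_mem_legs_liftSubgraph {D : Finset (G.HighSubgraph c)} (hD : IsForest D)
    (η : (G.shrink c D).Subgraph) {h : G.H} (hh : h ∈ (liftSubgraph D η).legs) :
    ∀ δ ∈ D, h ∉ δ.1.carrier :=
  fun _ hδ hm => hh.2 (subset_liftSubgraph η hδ (Subgraph.mem_support_of_mem _ hm)
    ((mem_support_liftSubgraph hD η _).1 hh.1) hm)

/-- Lifting of paths: each step in the cograph is an edge of `G`, and between two steps `hs`
supplies a path inside a contracted member. The equivalence of memberships is carried through the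
induction to ensure that the path stays in `η`, where `hs` applies. -/
theorem linked_of_shrink {D : Finset (G.HighSubgraph c)} (η : (G.shrink c D).Subgraph)
    {t : Set (G.shrink c D).H} {s : Set G.H} (ht : t ⊆ η.carrier) (hts : ∀ h ∈ t, h.1 ∈ s)
    (hs : ∀ v w, shrinkMk D v = shrinkMk D w → shrinkMk D v ∈ η.support → G.Linked s v w)
    {x y : (G.shrink c D).V} (h : (G.shrink c D).Linked t x y) :
    (x ∈ η.support ↔ y ∈ η.support) ∧ (x ∈ η.support → ∀ v w, shrinkMk D v = x →
      shrinkMk D w = y → G.Linked s v w) := by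
  induction h with
  | rel x y h =>
    obtain ⟨h, hh, rfl, rfl⟩ := h
    have h1 := η.mem_support_of_mem (ht hh)
    have h2 := η.mem_support_of_mem (η.inv_mem _ (ht hh))
    refine ⟨iff_of_true h1 h2, fun _ v w hv hw => ?_⟩
    refine .trans _ _ _ (hs v (G.vert h.1) hv (by rw [hv]; exact h1)) ?_
    refine .trans _ _ _ ?_ (hs (G.vert (G.inv h.1)) w hw.symm h2)
    exact .rel _ _ ⟨h.1, hts h hh, rfl, rfl⟩
  | refl x => exact ⟨Iff.rfl, fun hx v w hv hw => hs v w (hv.trans hw.symm) (by rwa [hv])⟩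
  | symm x y _ ih =>
    exact ⟨ih.1.symm, fun hy v w hv hw => .symm _ _ (ih.2 (ih.1.2 hy) w v hw hv)⟩
  | trans x y z _ _ ih1 ih2 =>
    refine ⟨ih1.1.trans ih2.1, fun hx v w hv hw => ?_⟩
    obtain ⟨u, hu⟩ := Quot.exists_rep y
    exact .trans _ _ _ (ih1.2 hx v u hv hu) (ih2.2 (ih1.1.1 hx) u w hu hw)

/-- When `e` is an edge of `η`, a path in `η` avoiding it is lifted, and the contracted members on
the way are crossed along their own edges, which do not include `e`. When `e` lies in a contracted
member `δ₀`, any path in `η` will do, and `δ₀` is crossed avoiding `e` because it is 1PI itself. -/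
theorem isOnePI_liftSubgraph {D : Finset (G.HighSubgraph c)} (hD : IsForest D)
    {η : (G.shrink c D).Subgraph} (hη : (η.toGraph c).IsOnePI) :
    ((liftSubgraph D η).toGraph c).IsOnePI := by
  obtain ⟨⟨x, hx⟩, h1, h2⟩ := (η.isOnePI_toGraph_iff c).1 hη
  have hsupp := mem_support_liftSubgraph hD η
  refine (Subgraph.isOnePI_toGraph_iff c _).2 ⟨⟨x.1, (mem_liftSubgraph η x).2 hx⟩, ?_, ?_⟩
  · intro v hv w hw
    rw [hsupp] at hv hw
    refine (linked_of_shrink η subset_rfl (fun h hh => (mem_liftSubgraph η h).2 hh) ?_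
      (h1 _ hv _ hw)).2 hv v w rfl rfl
    intro v w hvw hv
    rcases (hD.mk_eq_iff v w).1 hvw with rfl | ⟨δ, hδ, h3, h4⟩
    · exact .refl _
    · exact (δ.linked v h3 w h4).mono (subset_liftSubgraph η hδ h3 hv)
  · intro e he v hv w hw
    rw [hsupp] at hv hw
    rcases he with ⟨hn, he⟩ | ⟨δ₀, hδ₀, he, hev⟩
    · refine (linked_of_shrink η Set.sdiff_subset ?_ ?_ (h2 _ he _ hv _ hw)).2 hv v w rfl rfl
      · rintro h ⟨hh, hne⟩
        refine ⟨(mem_liftSubgraph η h).2 hh, ?_⟩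
        rintro (h3 | h3)
        · exact hne (Or.inl (Subtype.ext h3))
        · exact hne (Or.inr (Subtype.ext h3))
      · intro v w hvw hv
        rcases (hD.mk_eq_iff v w).1 hvw with rfl | ⟨δ, hδ, h3, h4⟩
        · exact .refl _
        · refine (δ.linked v h3 w h4).mono (t := (liftSubgraph D η).carrier \ {e, G.inv e})
            fun k hk => ⟨subset_liftSubgraph η hδ h3 hv hk, ?_⟩
          rintro (rfl | rfl)
          · exact hn δ hδ hk
          · exact hn δ hδ ((δ.1.inv_mem_iff _).1 hk)
    · refine (linked_of_shrink η subset_rfl ?_ ?_ (h1 _ hv _ hw)).2 hv v w rfl rfl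
      · intro h hh
        refine ⟨(mem_liftSubgraph η h).2 hh, ?_⟩
        rintro (h3 | h3)
        · exact h.2 δ₀ hδ₀ (h3 ▸ he)
        · exact h.2 δ₀ hδ₀ (h3 ▸ δ₀.1.inv_mem _ he)
      · intro v w hvw hv
        rcases (hD.mk_eq_iff v w).1 hvw with rfl | ⟨δ, hδ, h3, h4⟩
        · exact .refl _
        · have hsub := subset_liftSubgraph η hδ h3 hv
          by_cases hδe : δ = δ₀
          · subst hδe
            exact (δ.linked_diff e he v h3 w h4).mono (Set.sdiff_subset_sdiff_left hsub)
          · refine (δ.linked v h3 w h4).mono (t := (liftSubgraph D η).carrier \ {e, G.inv e})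
              fun k hk => ⟨hsub hk, ?_⟩
            have hk' : k ∉ δ₀.1.carrier := Subgraph.not_mem_of_disjoint
              (hD δ hδ δ₀ hδ₀ hδe) (δ.1.mem_support_of_mem hk)
            rintro (rfl | rfl)
            · exact hk' he
            · exact hk' (δ₀.1.inv_mem _ he)

/-- Highness is transitive: if `δ` is reinserted at a vertex of `η`, some edge `k` of `η` ends there
and is a leg of `δ`. So the edges of `δ` lie above `k`, and `k` lies above all legs of `η`. -/
theorem isHighDivergent_liftSubgraph {D : Finset (G.HighSubgraph c)} (hD : IsForest D)
    {η : (G.shrink c D).Subgraph} (hη : η.IsHighDivergent c) :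
    (liftSubgraph D η).IsHighDivergent c where
  onePI := isOnePI_liftSubgraph hD hη.onePI
  points := by
    have e : (liftSubgraph D η).legs ≃ η.legs :=
      { toFun := fun h => ⟨⟨h.1, not_mem_of_mem_legs_liftSubgraph hD η h.2⟩,
          (mem_legs_liftSubgraph hD η ⟨_, not_mem_of_mem_legs_liftSubgraph hD η h.2⟩).1 h.2⟩
        invFun := fun h => ⟨h.1.1, (mem_legs_liftSubgraph hD η _).2 h.2⟩
        left_inv := fun _ => rfl
        right_inv := fun _ => rfl }
    rw [Nat.card_congr e]
    exact hη.points
  high := by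
    intro h hh l hl
    have hl' := (mem_legs_liftSubgraph hD η ⟨l, not_mem_of_mem_legs_liftSubgraph hD η hl⟩).1 hl
    rcases hh with ⟨hn, hh⟩ | ⟨δ, hδ, hh, k, hk, hkv⟩
    · exact hη.high _ hh _ hl'
    · refine (hη.high k hk _ hl').trans (δ.2.high h hh k.1 ⟨?_, k.2 δ hδ⟩)
      exact hD.mem_support_of_mk_eq hδ (δ.1.mem_support_of_mem hh) hkv.symm

/-- The high subgraph of `G` which corresponds to one of the cograph. -/
def liftHigh {D : Finset (G.HighSubgraph c)} (hD : IsForest D) :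
    (G.shrink c D).HighSubgraph c ↪ G.HighSubgraph c where
  toFun η := ⟨liftSubgraph D η.1, isHighDivergent_liftSubgraph hD η.2⟩
  inj' η η' h := by
    apply HighSubgraph.ext_carrier
    ext x
    have h' : liftSubgraph D η.1 = liftSubgraph D η'.1 := congrArg Subtype.val h
    rw [← mem_liftSubgraph η.1, h', mem_liftSubgraph]

theorem mem_liftHigh {D : Finset (G.HighSubgraph c)} (hD : IsForest D)
    (η : (G.shrink c D).HighSubgraph c) (h : (G.shrink c D).H) :
    h.1 ∈ (liftHigh hD η).1.carrier ↔ h ∈ η.1.carrier :=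
  mem_liftSubgraph η.1 h

theorem mem_support_liftHigh {D : Finset (G.HighSubgraph c)} (hD : IsForest D)
    (η : (G.shrink c D).HighSubgraph c) (v : G.V) :
    v ∈ (liftHigh hD η).1.support ↔ shrinkMk D v ∈ η.1.support :=
  mem_support_liftSubgraph hD η.1 v

theorem liftHigh_notMem {D : Finset (G.HighSubgraph c)} (hD : IsForest D)
    (η : (G.shrink c D).HighSubgraph c) : liftHigh hD η ∉ D := by
  intro h
  obtain ⟨x, hx⟩ := η.nonempty
  exact x.2 _ h ((mem_liftHigh hD η x).2 hx)

theorem isCompatible_liftHigh {D : Finset (G.HighSubgraph c)} (hD : IsForest D)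
    (η : (G.shrink c D).HighSubgraph c) : IsCompatible D (liftHigh hD η) := by
  intro δ hδ
  by_cases h : Disjoint δ.1.support (liftHigh hD η).1.support
  · exact Or.inr h
  · obtain ⟨v, hv, hv'⟩ := Set.not_disjoint_iff.1 h
    exact Or.inl (subset_liftSubgraph η.1 hδ hv ((mem_support_liftHigh hD η v).1 hv'))

theorem disjoint_liftHigh_iff {D : Finset (G.HighSubgraph c)} (hD : IsForest D)
    (η η' : (G.shrink c D).HighSubgraph c) :
    Disjoint (liftHigh hD η).1.support (liftHigh hD η').1.support ↔
      Disjoint η.1.support η'.1.support := by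
  simp only [Set.disjoint_left, mem_support_liftHigh]
  exact ⟨fun h v => by obtain ⟨v, rfl⟩ := Quot.exists_rep v; exact @h v, fun h v => @h _⟩

/-- The preimage consists of the edges of `γ` outside the members of `D`. Compatibility ensures that
the lift adds back exactly the members inside `γ`, and `γ ∉ D` that some edge remains. -/
theorem exists_liftHigh_eq {D : Finset (G.HighSubgraph c)} (hD : IsForest D)
    {γ : G.HighSubgraph c} (hγ : γ ∉ D) (hc : IsCompatible D γ) :
    ∃ η, liftHigh hD η = γ := by
  let η : (G.shrink c D).Subgraph :=
    { carrier := {h | h.1 ∈ γ.1.carrier}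
      inv_mem := fun h hh => γ.1.inv_mem _ hh
      subset_internal := fun h hh h' => γ.1.subset_internal hh (congrArg Subtype.val h') }
  have hs : ∀ v, shrinkMk D v ∈ η.support ↔ v ∈ γ.1.support := by
    intro v
    constructor
    · rintro ⟨h, hh, hv⟩
      have hh' := γ.1.mem_support_of_mem hh
      rcases (hD.mk_eq_iff _ _).1 hv with rfl | ⟨δ, hδ, h1, h2⟩
      · exact hh'
      · exact Subgraph.support_mono (hc.subset hδ h1 hh') h2
    · rintro ⟨h, hh, rfl⟩
      by_cases hn : ∀ δ ∈ D, h ∉ δ.1.carrier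
      · exact ⟨⟨h, hn⟩, hh, rfl⟩
      · push Not at hn
        obtain ⟨δ, hδ, hm⟩ := hn
        have hsub := hc.subset hδ (δ.1.mem_support_of_mem hm) (γ.1.mem_support_of_mem hh)
        -- The vertex to which `δ` is contracted is an end point of `η`: connectedness of `γ` gives
        -- an edge of `γ` leaving `δ`, and it belongs to no other member of `D`.
        obtain ⟨k, hk, hkδ, hkv⟩ := Subgraph.exists_leg_mem hsub γ.linked δ.nonempty fun h =>
          hγ (by rwa [HighSubgraph.ext_carrier (h.antisymm hsub)])
        refine ⟨⟨k, fun δ' hδ' hm' => ?_⟩, hk, Quot.sound ⟨δ, hδ, hkv, δ.1.mem_support_of_mem hm⟩⟩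
        obtain rfl := hD.eq_of_mem hδ hδ' hkv (δ'.1.mem_support_of_mem hm')
        exact hkδ hm'
  have hcar : (liftSubgraph D η).carrier = γ.1.carrier := by
    ext h
    constructor
    · rintro (⟨_, hm⟩ | ⟨δ, hδ, hm, hv⟩)
      · exact hm
      · exact hc.subset hδ (δ.1.mem_support_of_mem hm) ((hs _).1 hv) hm
    · intro hh
      by_cases hn : ∀ δ ∈ D, h ∉ δ.1.carrier
      · exact Or.inl ⟨hn, hh⟩
      · push Not at hn
        obtain ⟨δ, hδ, hm⟩ := hn
        exact Or.inr ⟨δ, hδ, hm, (hs _).2 (γ.1.mem_support_of_mem hh)⟩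
  have hsub : liftSubgraph D η = γ.1 := Subgraph.ext hcar
  have hlegs : ∀ h : (G.shrink c D).H, h ∈ η.legs ↔ h.1 ∈ γ.1.legs := by
    intro h
    rw [← mem_legs_liftSubgraph hD η h, hsub]
  have hη : η.IsHighDivergent c :=
    { onePI := by
        -- As a graph, `η` is `γ` with the members of `D` inside it contracted, and contraction
        -- preserves 1PI.
        have hp := (hD.isProperForest_restrict_iff γ).2 hγ
        have e := quotientIso hD hc η (fun _ => Iff.rfl) hs
        refine e.symm.isOnePI ?_
        exact hp.isOnePI_shrink γ.2.onePI
      points := by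
        have e : η.legs ≃ γ.1.legs :=
          { toFun := fun h => ⟨h.1.1, (hlegs _).1 h.2⟩
            invFun := fun h =>
              have hn := not_mem_of_mem_legs_liftSubgraph hD η (h := h.1) (by rw [hsub]; exact h.2)
              ⟨⟨h.1, hn⟩, (hlegs ⟨h.1, hn⟩).2 h.2⟩
            left_inv := fun _ => rfl
            right_inv := fun _ => rfl }
        rw [Nat.card_congr e]
        exact γ.2.points
      high := fun h hh l hl => γ.2.high h.1 hh l.1 ((hlegs l).1 hl) }
  exact ⟨⟨η, hη⟩, Subtype.ext hsub⟩

/-- A high subgraph of the cograph is the cograph of the corresponding subgraph. -/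
noncomputable def liftHighIso {D : Finset (G.HighSubgraph c)} (hD : IsForest D)
    (η : (G.shrink c D).HighSubgraph c) :
    (η.1.toGraph c).Iso (((liftHigh hD η).1.toGraph c).shrink c ((liftHigh hD η).restrict D)) :=
  quotientIso hD (isCompatible_liftHigh hD η) η.1 (fun h => (mem_liftHigh hD η h).symm)
    (fun v => (mem_support_liftHigh hD η v).symm)

end ScaledGraph

end AssignedGraphs

/-! ### The correspondence between forests of `G / D` and forests of `G` refined by `D` -/

namespace AssignedGraphs

namespace ScaledGraph

variable {c : LegConvention} {ρ : ℕ} {G : ScaledGraph}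

/-! ### Forests of cographs -/

/-- Every member of `D` is contained in a member of `F`. -/
def Refines (D F : Finset (G.HighSubgraph c)) : Prop :=
  ∀ δ ∈ D, ∃ γ ∈ F, δ.1.carrier ⊆ γ.1.carrier

theorem HighSubgraph.not_disjoint_of_subset {γ δ : G.HighSubgraph c}
    (h : δ.1.carrier ⊆ γ.1.carrier) : ¬ Disjoint δ.1.support γ.1.support :=
  fun hd => δ.not_disjoint_self (hd.mono_right (Subgraph.support_mono h))

theorem Refines.isCompatible {D F : Finset (G.HighSubgraph c)} (h : Refines D F)
    (hF : IsForest F) {γ : G.HighSubgraph c} (hγ : γ ∈ F) : IsCompatible D γ := by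
  intro δ hδ
  obtain ⟨γ', hγ', hsub⟩ := h δ hδ
  by_cases hne : γ' = γ
  · exact Or.inl (hne ▸ hsub)
  · exact Or.inr ((hF γ' hγ' γ hγ hne).mono_left (Subgraph.support_mono hsub))

theorem Refines.isProperForest {D F : Finset (G.HighSubgraph c)} (h : Refines D F)
    (hD : IsForest D) (hF : IsProperForest F) : IsProperForest D := by
  obtain ⟨x, hx, hn⟩ := hF.proper
  refine ⟨hD, x, hx, fun δ hδ hm => ?_⟩
  obtain ⟨γ, hγ, hsub⟩ := h δ hδ
  exact hn γ hγ (hsub hm)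

/-- The forest of the cograph `G / D` induced by a forest of `G`. -/
noncomputable def pushForest {D : Finset (G.HighSubgraph c)} (hD : IsForest D)
    (F : Finset (G.HighSubgraph c)) : Finset ((G.shrink c D).HighSubgraph c) :=
  F.preimage (liftHigh hD) (liftHigh hD).injective.injOn

theorem mem_pushForest {D : Finset (G.HighSubgraph c)} (hD : IsForest D)
    (F : Finset (G.HighSubgraph c)) (η : (G.shrink c D).HighSubgraph c) :
    η ∈ pushForest hD F ↔ liftHigh hD η ∈ F :=
  Finset.mem_preimage

open Classical in
/-- The forest of `G` which corresponds to a forest of the cograph `G / D`: it also contains those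
members of `D` which are not vertices of the latter. -/
noncomputable def liftForest {D : Finset (G.HighSubgraph c)} (hD : IsForest D)
    (E : Finset ((G.shrink c D).HighSubgraph c)) : Finset (G.HighSubgraph c) :=
  E.map (liftHigh hD) ∪ D.filter fun δ => ∀ η ∈ E, ¬ δ.1.carrier ⊆ (liftHigh hD η).1.carrier

theorem mem_liftForest {D : Finset (G.HighSubgraph c)} (hD : IsForest D)
    (E : Finset ((G.shrink c D).HighSubgraph c)) (γ : G.HighSubgraph c) :
    γ ∈ liftForest hD E ↔ (∃ η ∈ E, liftHigh hD η = γ) ∨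
      (γ ∈ D ∧ ∀ η ∈ E, ¬ γ.1.carrier ⊆ (liftHigh hD η).1.carrier) := by
  simp [liftForest]

theorem refines_liftForest {D : Finset (G.HighSubgraph c)} (hD : IsForest D)
    (E : Finset ((G.shrink c D).HighSubgraph c)) : Refines D (liftForest hD E) := by
  intro δ hδ
  by_cases h : ∃ η ∈ E, δ.1.carrier ⊆ (liftHigh hD η).1.carrier
  · obtain ⟨η, hη, hsub⟩ := h
    exact ⟨_, (mem_liftForest hD E _).2 (Or.inl ⟨η, hη, rfl⟩), hsub⟩
  · push Not at h
    exact ⟨δ, (mem_liftForest hD E _).2 (Or.inr ⟨hδ, h⟩), subset_rfl⟩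

theorem pushForest_liftForest {D : Finset (G.HighSubgraph c)} (hD : IsForest D)
    (E : Finset ((G.shrink c D).HighSubgraph c)) : pushForest hD (liftForest hD E) = E := by
  ext η
  rw [mem_pushForest, mem_liftForest]
  constructor
  · rintro (⟨η', h, h'⟩ | ⟨h, _⟩)
    · rwa [← (liftHigh hD).injective h']
    · exact absurd h (liftHigh_notMem hD η)
  · exact fun h => Or.inl ⟨η, h, rfl⟩

/-- A member of `D` that is kept is not contained in any lift, hence disjoint from all lifts by
compatibility. -/
theorem isForest_liftForest {D : Finset (G.HighSubgraph c)} (hD : IsForest D)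
    {E : Finset ((G.shrink c D).HighSubgraph c)} (hE : IsForest E) :
    IsForest (liftForest hD E) := by
  intro γ hγ γ' hγ' hne
  rcases (mem_liftForest hD E γ).1 hγ with ⟨η, hη, rfl⟩ | ⟨h1, h2⟩ <;>
  rcases (mem_liftForest hD E γ').1 hγ' with ⟨η', hη', rfl⟩ | ⟨h3, h4⟩
  · exact (disjoint_liftHigh_iff hD η η').2 (hE η hη η' hη' fun h => hne (h ▸ rfl))
  · exact ((isCompatible_liftHigh hD η γ' h3).resolve_left (h4 η hη)).symm
  · exact (isCompatible_liftHigh hD η' γ h1).resolve_left (h2 η' hη')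
  · exact hD γ h1 γ' h3 hne

theorem isProperForest_liftForest {D : Finset (G.HighSubgraph c)} (hD : IsForest D)
    {E : Finset ((G.shrink c D).HighSubgraph c)} (hE : IsProperForest E) :
    IsProperForest (liftForest hD E) := by
  obtain ⟨x, hx, hn⟩ := hE.proper
  refine ⟨isForest_liftForest hD hE.forest, x.1, fun h => hx (Subtype.ext h), fun γ hγ hm => ?_⟩
  rcases (mem_liftForest hD E γ).1 hγ with ⟨η, hη, rfl⟩ | ⟨h1, _⟩
  · exact hn η hη ((mem_liftHigh hD η x).1 hm)
  · exact x.2 γ h1 hm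

theorem isForest_pushForest {D F : Finset (G.HighSubgraph c)} (hD : IsForest D)
    (hF : IsForest F) : IsForest (pushForest hD F) :=
  fun η hη η' hη' hne => (disjoint_liftHigh_iff hD η η').1
    (hF _ ((mem_pushForest hD F η).1 hη) _ ((mem_pushForest hD F η').1 hη')
      fun h => hne ((liftHigh hD).injective h))

theorem isProperForest_pushForest {D F : Finset (G.HighSubgraph c)} (hD : IsForest D)
    (hF : IsProperForest F) (hDF : Refines D F) : IsProperForest (pushForest hD F) := by
  obtain ⟨x, hx, hn⟩ := hF.proper
  have hxD : ∀ δ ∈ D, x ∉ δ.1.carrier := fun δ hδ hm =>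
    have ⟨γ, hγ, hsub⟩ := hDF δ hδ
    hn γ hγ (hsub hm)
  exact ⟨isForest_pushForest hD hF.forest, ⟨x, hxD⟩, fun h => hx (congrArg Subtype.val h),
    fun η hη hm => hn _ ((mem_pushForest hD F η).1 hη) ((mem_liftHigh hD η _).2 hm)⟩

/-- Members of `F` outside `D` are compatible with `D` and therefore lifts. A member of `D`
contained in no such lift lies in a member of `F` which is also in `D`, and equals it by
disjointness; conversely, disjointness in `F` keeps the members of `F` in `D` out of all lifts. -/
theorem liftForest_pushForest {D F : Finset (G.HighSubgraph c)} (hD : IsForest D)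
    (hF : IsForest F) (hDF : Refines D F) : liftForest hD (pushForest hD F) = F := by
  ext γ
  simp only [mem_liftForest, mem_pushForest]
  constructor
  · rintro (⟨η, hη, rfl⟩ | ⟨h1, h2⟩)
    · exact hη
    · obtain ⟨γ', hγ', hsub⟩ := hDF γ h1
      by_cases h3 : γ' ∈ D
      · have := hD.eq_of_mem h1 h3 (γ.1.mem_support_of_mem γ.nonempty.some_mem)
          (γ'.1.mem_support_of_mem (hsub γ.nonempty.some_mem))
        rwa [this]
      · obtain ⟨η, rfl⟩ := exists_liftHigh_eq hD h3 (hDF.isCompatible hF hγ')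
        exact absurd hsub (h2 η hγ')
  · intro hγ
    by_cases h3 : γ ∈ D
    · refine Or.inr ⟨h3, fun η hη hsub => ?_⟩
      have := hF.eq_of_mem hγ hη (γ.1.mem_support_of_mem γ.nonempty.some_mem)
        ((liftHigh hD η).1.mem_support_of_mem (hsub γ.nonempty.some_mem))
      exact liftHigh_notMem hD η (this ▸ h3)
    · obtain ⟨η, rfl⟩ := exists_liftHigh_eq hD h3 (hDF.isCompatible hF hγ)
      exact Or.inl ⟨η, hγ, rfl⟩

/-- Shrinking in two steps. -/
noncomputable def shrinkShrinkIso (hG : Function.Surjective G.vert)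
    {D : Finset (G.HighSubgraph c)} (hD : IsForest D)
    {E : Finset ((G.shrink c D).HighSubgraph c)} (hE : IsForest E) :
    ((G.shrink c D).shrink c E).Iso (G.shrink c (liftForest hD E)) :=
  have aux : ∀ h : G.H, (∀ γ ∈ liftForest hD E, h ∉ γ.1.carrier) →
      ∀ δ ∈ D, h ∉ δ.1.carrier := fun h hn δ hδ hm =>
    have ⟨γ, hγ, hsub⟩ := refines_liftForest hD E δ hδ
    hn γ hγ (hsub hm)
  Iso.ofHalfEdges (hE.shrink_vert_surjective (hD.shrink_vert_surjective hG))
    ((isForest_liftForest hD hE).shrink_vert_surjective hG)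
    { toFun := fun h => ⟨h.1.1, by
        intro γ hγ hm
        rcases (mem_liftForest hD E γ).1 hγ with ⟨η, hη, rfl⟩ | ⟨h1, _⟩
        · exact h.2 η hη ((mem_liftHigh hD η h.1).1 hm)
        · exact h.1.2 γ h1 hm⟩
      invFun := fun h => ⟨⟨h.1, aux h.1 h.2⟩, fun η hη hm =>
        h.2 _ ((mem_liftForest hD E _).2 (Or.inl ⟨η, hη, rfl⟩)) ((mem_liftHigh hD η _).2 hm)⟩
      left_inv := fun _ => rfl
      right_inv := fun _ => rfl }
    (fun h h' => by
      refine (hE.mk_eq_iff (shrinkMk D (G.vert h.1.1)) (shrinkMk D (G.vert h'.1.1))).trans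
        (Iff.trans ?_ ((isForest_liftForest hD hE).mk_eq_iff _ _).symm)
      -- Identification by `D` followed by identification by `E` is matched with identification by
      -- the lifted forest; every member of `D` lies in a member of the latter.
      refine Iff.trans (or_congr (hD.mk_eq_iff _ _) Iff.rfl) ?_
      constructor
      · rintro ((h1 | ⟨δ, hδ, h1, h2⟩) | ⟨η, hη, h1, h2⟩)
        · exact Or.inl h1
        · obtain ⟨γ, hγ, hsub⟩ := refines_liftForest hD E δ hδ
          exact Or.inr ⟨γ, hγ, Subgraph.support_mono hsub h1, Subgraph.support_mono hsub h2⟩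
        · exact Or.inr ⟨_, (mem_liftForest hD E _).2 (Or.inl ⟨η, hη, rfl⟩),
            (mem_support_liftHigh hD η _).2 h1, (mem_support_liftHigh hD η _).2 h2⟩
      · rintro (h1 | ⟨γ, hγ, h1, h2⟩)
        · exact Or.inl (Or.inl h1)
        · rcases (mem_liftForest hD E γ).1 hγ with ⟨η, hη, rfl⟩ | ⟨h3, _⟩
          · exact Or.inr ⟨η, hη, (mem_support_liftHigh hD η _).1 h1,
              (mem_support_liftHigh hD η _).1 h2⟩
          · exact Or.inl (Or.inr ⟨γ, h3, h1, h2⟩))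
    (fun _ => rfl) (fun _ => rfl)

/-- All proper forests of a graph. -/
noncomputable def properForests (c : LegConvention) (G : ScaledGraph) :
    Finset (Finset (G.HighSubgraph c)) :=
  (Set.toFinite {F | IsProperForest F}).toFinset

theorem mem_properForests {F : Finset (G.HighSubgraph c)} :
    F ∈ properForests c G ↔ IsProperForest F := by
  simp [properForests]

/-- All forests contained in a given one. -/
noncomputable def refinements (F : Finset (G.HighSubgraph c)) :
    Finset (Finset (G.HighSubgraph c)) :=
  (Set.toFinite {D | IsForest D ∧ Refines D F}).toFinset

theorem mem_refinements {D F : Finset (G.HighSubgraph c)} :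
    D ∈ refinements F ↔ IsForest D ∧ Refines D F := by
  simp [refinements]

theorem HighSubgraph.restrict_congr (γ : G.HighSubgraph c) {D D' : Finset (G.HighSubgraph c)}
    (h : ∀ δ : G.HighSubgraph c, δ.1.carrier ⊆ γ.1.carrier → (δ ∈ D ↔ δ ∈ D')) :
    γ.restrict D = γ.restrict D' := by
  ext δ
  rw [mem_restrict, mem_restrict, h _ (γ.incl_subset δ)]

end ScaledGraph

end AssignedGraphs

/-! ### Coassociativity by summation over nested forests -/

namespace AssignedGraphs

open ScaledGraph AssignedGraph

section Coassociativity

variable (K : Type*) [Field K] {c : LegConvention} {ρ : ℕ} {G : ScaledGraph}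

/-! ### The coproduct as a sum over forests -/

/-- The disjoint union of the members of a forest. -/
noncomputable def forestUnion (hG : G.IsAssigned c ρ) (F : Finset (G.HighSubgraph c)) :
    HopfAlg K c ρ :=
  ∏ γ ∈ F, MvPolynomial.X (mk (γ.1.toGraph c) (toGraph_isAssigned hG γ))

open Classical in
/-- The cograph of a proper forest; forests which exhaust all edges have a trivial cograph. -/
noncomputable def cographOf (hG : G.IsAssigned c ρ) (F : Finset (G.HighSubgraph c)) :
    HopfAlg K c ρ :=
  if hF : IsProperForest F then MvPolynomial.X (mk (G.shrink c F) (hF.shrink_isAssigned hG)) else 1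

theorem cographOf_pos (hG : G.IsAssigned c ρ) {F : Finset (G.HighSubgraph c)}
    (hF : IsProperForest F) : cographOf K hG F =
      MvPolynomial.X (mk (G.shrink c F) (hF.shrink_isAssigned hG)) :=
  dif_pos hF

theorem cographOf_neg (hG : G.IsAssigned c ρ) {F : Finset (G.HighSubgraph c)}
    (hF : ¬ IsProperForest F) : cographOf K hG F = 1 :=
  dif_neg hF

theorem isProperForest_empty (hG : G.IsAssigned c ρ) :
    IsProperForest (∅ : Finset (G.HighSubgraph c)) := by
  obtain ⟨h, hh⟩ := hG.onePI.nonempty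
  exact ⟨isForest_empty, h, hh, fun _ h => absurd h (Finset.notMem_empty _)⟩

theorem cographOf_empty (hG : G.IsAssigned c ρ) :
    cographOf K hG ∅ = MvPolynomial.X (mk G hG) := by
  rw [cographOf_pos K hG (isProperForest_empty hG)]
  exact congrArg _ (mk_eq _ _ (shrinkEmpty c G).symm)

theorem sum_extractions_mk {M : Type*} [AddCommMonoid M] (hG : G.IsAssigned c ρ)
    (f : Multiset (AssignedGraph c ρ) × AssignedGraph c ρ → M) :
    letI : Fintype (G.Extraction c) := Fintype.ofFinite _
    ((AssignedGraph.mk G hG).extractions.map f).sum =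
      ∑ F : G.Extraction c, f (parts G hG F, cograph G hG F) := by
  change ((extractionsOf G hG).map f).sum = _
  rw [extractionsOf, Multiset.map_map]
  rfl

theorem union_parts (hG : G.IsAssigned c ρ) (F : G.Extraction c) :
    union K c ρ (parts G hG F) = forestUnion K hG F.1 := by
  rw [union, parts, Multiset.map_map]
  rfl

/-- The empty forest supplies `1 ⊗ G`, so that only `G ⊗ 1` stays apart from the sum. -/
theorem coproduct_X_mk (hG : G.IsAssigned c ρ) :
    coproduct K c ρ (MvPolynomial.X (mk G hG)) = MvPolynomial.X (mk G hG) ⊗ₜ[K] 1 +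
      ∑ F ∈ properForests c G, forestUnion K hG F ⊗ₜ[K] cographOf K hG F := by
  classical
  let _ : Fintype (G.Extraction c) := Fintype.ofFinite _
  rw [coproduct, MvPolynomial.aeval_X, sum_extractions_mk, add_assoc]
  congr 1
  rw [← Finset.add_sum_erase _ _ (mem_properForests.2 (isProperForest_empty hG)),
    cographOf_empty, forestUnion, Finset.prod_empty]
  congr 1
  have hmem : ∀ F : Finset (G.HighSubgraph c),
      F ∈ (properForests c G).erase ∅ ↔ IsExtraction c F := by
    intro F
    rw [Finset.mem_erase, mem_properForests]
    exact ⟨fun h => h.2.isExtraction (Finset.nonempty_iff_ne_empty.2 h.1),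
      fun h => ⟨h.nonempty.ne_empty, h.isProperForest⟩⟩
  rw [Finset.sum_subtype _ hmem]
  refine Finset.sum_congr rfl fun F _ => ?_
  rw [union_parts, cographOf_pos K hG F.2.isProperForest]
  rfl

theorem forestUnion_map_incl (hG : G.IsAssigned c ρ) (γ : G.HighSubgraph c)
    (E : Finset ((γ.1.toGraph c).HighSubgraph c)) :
    forestUnion K hG (E.map γ.incl) = forestUnion K (toGraph_isAssigned hG γ) E := by
  rw [forestUnion, Finset.prod_map]
  exact Finset.prod_congr rfl fun δ _ => congrArg _ (mk_eq _ _ (γ.1.inclIso δ.1).symm)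

/-- The cograph `γ / D` of a high subgraph, where the members of `D` contained in `γ` are shrunk. -/
noncomputable def relCograph (hG : G.IsAssigned c ρ) (D : Finset (G.HighSubgraph c))
    (γ : G.HighSubgraph c) : HopfAlg K c ρ :=
  cographOf K (toGraph_isAssigned hG γ) (γ.restrict D)

theorem relCograph_of_mem (hG : G.IsAssigned c ρ) {D : Finset (G.HighSubgraph c)}
    (hD : IsForest D) {γ : G.HighSubgraph c} (hγ : γ ∈ D) : relCograph K hG D γ = 1 :=
  cographOf_neg K _ fun h => (hD.isProperForest_restrict_iff γ).1 h hγ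

theorem relCograph_congr (hG : G.IsAssigned c ρ) {D D' : Finset (G.HighSubgraph c)}
    {γ : G.HighSubgraph c}
    (h : ∀ δ : G.HighSubgraph c, δ.1.carrier ⊆ γ.1.carrier → (δ ∈ D ↔ δ ∈ D')) :
    relCograph K hG D γ = relCograph K hG D' γ := by
  rw [relCograph, γ.restrict_congr h, relCograph]

/-- Here `γ ⊗ 1` joins the sum as well, as the term of `D = {γ}` with γ/γ = 1; every other
refinement is a proper forest of `γ`. -/
theorem coproduct_X_highSubgraph (hG : G.IsAssigned c ρ) (γ : G.HighSubgraph c) :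
    coproduct K c ρ (MvPolynomial.X (mk (γ.1.toGraph c) (toGraph_isAssigned hG γ))) =
      ∑ D ∈ refinements {γ}, forestUnion K hG D ⊗ₜ[K] relCograph K hG D γ := by
  classical
  have href : ∀ D : Finset (G.HighSubgraph c),
      Refines D {γ} ↔ ∀ δ ∈ D, δ.1.carrier ⊆ γ.1.carrier := fun D => by simp [Refines]
  have hsing : IsForest ({γ} : Finset (G.HighSubgraph c)) := by
    intro δ hδ δ' hδ' hne
    rw [Finset.mem_singleton] at hδ hδ'
    exact absurd (hδ.trans hδ'.symm) hne
  have hmem : {γ} ∈ refinements {γ} :=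
    mem_refinements.2 ⟨hsing, (href _).2 fun δ hδ => by rw [Finset.mem_singleton.1 hδ]⟩
  rw [coproduct_X_mk, ← Finset.add_sum_erase _ _ hmem,
    relCograph_of_mem K hG hsing (Finset.mem_singleton_self γ), forestUnion,
    Finset.prod_singleton]
  congr 1
  refine Finset.sum_bij' (fun E _ => E.map γ.incl) (fun D _ => γ.restrict D) ?_ ?_ ?_ ?_ ?_
  · intro E hE
    rw [mem_properForests] at hE
    rw [Finset.mem_erase, mem_refinements, href]
    refine ⟨fun h => ?_, hE.forest.map_incl, fun δ hδ => ?_⟩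
    · have h1 := (hsing.isProperForest_restrict_iff γ).1
      rw [← h, γ.restrict_map_incl, h] at h1
      exact h1 hE (Finset.mem_singleton_self γ)
    · obtain ⟨δ, _, rfl⟩ := Finset.mem_map.1 hδ
      exact γ.incl_subset δ
  · intro D hD
    rw [Finset.mem_erase, mem_refinements, href] at hD
    rw [mem_properForests, hD.2.1.isProperForest_restrict_iff]
    -- If `γ ∈ D`, any further member would be both contained in `γ` and disjoint from it, so `D =
    -- {γ}`.
    refine fun h => hD.1 (Finset.eq_singleton_iff_unique_mem.2 ⟨h, fun δ hδ => ?_⟩)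
    by_contra hne
    exact HighSubgraph.not_disjoint_of_subset (hD.2.2 δ hδ)
      (hD.2.1 δ hδ γ h hne)
  · intro E _
    exact γ.restrict_map_incl E
  · intro D hD
    rw [Finset.mem_erase, mem_refinements, href] at hD
    exact γ.map_incl_restrict hD.2.2
  · intro E _
    rw [forestUnion_map_incl, relCograph, γ.restrict_map_incl]

/-- Since the members of `F` are disjoint, choosing a refinement of `F` is the same as choosing one
of each member independently; this is the expansion of the product of their coproducts. -/
theorem coproduct_forestUnion (hG : G.IsAssigned c ρ) {F : Finset (G.HighSubgraph c)}
    (hF : IsForest F) : coproduct K c ρ (forestUnion K hG F) =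
      ∑ D ∈ refinements F, forestUnion K hG D ⊗ₜ[K] ∏ γ ∈ F, relCograph K hG D γ := by
  classical
  induction F using Finset.induction_on with
  | empty =>
    have : refinements (∅ : Finset (G.HighSubgraph c)) = {∅} := by
      ext D
      rw [mem_refinements, Finset.mem_singleton]
      constructor
      · rintro ⟨_, h⟩
        refine Finset.eq_empty_of_forall_notMem fun δ hδ => ?_
        obtain ⟨γ, hγ, _⟩ := h δ hδ
        exact Finset.notMem_empty _ hγ
      · rintro rfl
        exact ⟨isForest_empty, fun _ h => absurd h (Finset.notMem_empty _)⟩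
    rw [this, Finset.sum_singleton, forestUnion, Finset.prod_empty, Finset.prod_empty, map_one]
    rfl
  | insert γ F hγF ih =>
    have hF' : IsForest F := hF.mono (Finset.subset_insert _ _)
    have hdisj : ∀ γ' ∈ F, Disjoint γ.1.support γ'.1.support := fun γ' hγ' =>
      hF γ (Finset.mem_insert_self _ _) γ' (Finset.mem_insert_of_mem hγ')
        (fun h => hγF (h ▸ hγ'))
    have hsep : ∀ {δ : G.HighSubgraph c}, δ.1.carrier ⊆ γ.1.carrier →
        ∀ γ' ∈ F, ¬ δ.1.carrier ⊆ γ'.1.carrier := fun h γ' hγ' h' =>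
      HighSubgraph.not_disjoint_of_subset h'
        ((hdisj γ' hγ').mono_left (Subgraph.support_mono h))
    have hdis : ∀ {D₁ D₂ : Finset (G.HighSubgraph c)}, (∀ δ ∈ D₁, δ.1.carrier ⊆ γ.1.carrier) →
        Refines D₂ F → Disjoint D₁ D₂ := fun h1 h2 => Finset.disjoint_left.2 fun δ hδ hδ' =>
      have ⟨γ', hγ', hsub⟩ := h2 δ hδ'
      hsep (h1 δ hδ) γ' hγ' hsub
    have href : ∀ D : Finset (G.HighSubgraph c),
        Refines D {γ} ↔ ∀ δ ∈ D, δ.1.carrier ⊆ γ.1.carrier := fun D => by simp [Refines]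
    have hmul : forestUnion K hG (insert γ F) = MvPolynomial.X (mk (γ.1.toGraph c)
        (toGraph_isAssigned hG γ)) * forestUnion K hG F := Finset.prod_insert hγF
    rw [hmul, map_mul, ih hF', coproduct_X_highSubgraph, Finset.sum_mul_sum,
      ← Finset.sum_product']
    -- A refinement of `insert γ F` splits uniquely into the members inside `γ` and the remaining
    -- ones, which refine `F`.
    refine Finset.sum_bij' (fun p _ => p.1 ∪ p.2)
      (fun D _ => (D.filter fun δ => δ.1.carrier ⊆ γ.1.carrier,
        D.filter fun δ => ¬ δ.1.carrier ⊆ γ.1.carrier)) ?_ ?_ ?_ ?_ ?_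
    · rintro ⟨D₁, D₂⟩ hp
      rw [Finset.mem_product, mem_refinements, mem_refinements, href] at hp
      obtain ⟨⟨h1, h2⟩, h3, h4⟩ := hp
      have hcross : ∀ δ ∈ D₁, ∀ δ' ∈ D₂, Disjoint δ.1.support δ'.1.support := fun δ hδ δ' hδ' =>
        have ⟨γ', hγ', hsub⟩ := h4 δ' hδ'
        (hdisj γ' hγ').mono (Subgraph.support_mono (h2 δ hδ)) (Subgraph.support_mono hsub)
      rw [mem_refinements]
      constructor
      · intro δ hδ δ' hδ' hne
        rcases Finset.mem_union.1 hδ with hδ | hδ <;> rcases Finset.mem_union.1 hδ' with hδ' | hδ'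
        · exact h1 δ hδ δ' hδ' hne
        · exact hcross δ hδ δ' hδ'
        · exact (hcross δ' hδ' δ hδ).symm
        · exact h3 δ hδ δ' hδ' hne
      · intro δ hδ
        rcases Finset.mem_union.1 hδ with hδ | hδ
        · exact ⟨γ, Finset.mem_insert_self _ _, h2 δ hδ⟩
        · obtain ⟨γ', hγ', hsub⟩ := h4 δ hδ
          exact ⟨γ', Finset.mem_insert_of_mem hγ', hsub⟩
    · intro D hD
      rw [mem_refinements] at hD
      rw [Finset.mem_product, mem_refinements, mem_refinements, href]
      refine ⟨⟨hD.1.mono (Finset.filter_subset _ _), fun δ hδ => (Finset.mem_filter.1 hδ).2⟩,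
        hD.1.mono (Finset.filter_subset _ _), fun δ hδ => ?_⟩
      rw [Finset.mem_filter] at hδ
      obtain ⟨γ', hγ', hsub⟩ := hD.2 δ hδ.1
      rcases Finset.mem_insert.1 hγ' with rfl | hγ'
      · exact absurd hsub hδ.2
      · exact ⟨γ', hγ', hsub⟩
    · rintro ⟨D₁, D₂⟩ hp
      rw [Finset.mem_product, mem_refinements, mem_refinements, href] at hp
      obtain ⟨⟨h1, h2⟩, h3, h4⟩ := hp
      have h5 : ∀ δ ∈ D₂, ¬ δ.1.carrier ⊆ γ.1.carrier := fun δ hδ hsub =>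
        have ⟨γ', hγ', hsub'⟩ := h4 δ hδ
        hsep hsub γ' hγ' hsub'
      refine Prod.ext ?_ ?_
      · dsimp only
        rw [Finset.filter_union, Finset.filter_true_of_mem h2, Finset.filter_false_of_mem h5,
          Finset.union_empty]
      · dsimp only
        rw [Finset.filter_union, Finset.filter_true_of_mem h5,
          Finset.filter_false_of_mem fun δ hδ => not_not.2 (h2 δ hδ), Finset.empty_union]
    · intro D _
      exact Finset.filter_union_filter_not_eq _ _
    · rintro ⟨D₁, D₂⟩ hp
      rw [Finset.mem_product, mem_refinements, mem_refinements, href] at hp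
      obtain ⟨⟨h1, h2⟩, h3, h4⟩ := hp
      rw [Algebra.TensorProduct.tmul_mul_tmul, Finset.prod_insert hγF]
      have e1 : forestUnion K hG (D₁ ∪ D₂) = forestUnion K hG D₁ * forestUnion K hG D₂ :=
        Finset.prod_union (hdis h2 h4)
      have e2 : relCograph K hG (D₁ ∪ D₂) γ = relCograph K hG D₁ γ := by
        refine relCograph_congr K hG fun δ hδ => ?_
        rw [Finset.mem_union, or_iff_left]
        intro hδ'
        obtain ⟨γ', hγ', hsub⟩ := h4 δ hδ'
        exact hsep hδ γ' hγ' hsub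
      have e3 : ∀ γ' ∈ F, relCograph K hG (D₁ ∪ D₂) γ' = relCograph K hG D₂ γ' := by
        intro γ' hγ'
        refine relCograph_congr K hG fun δ hδ => ?_
        rw [Finset.mem_union, or_iff_right]
        exact fun hδ' => hsep (h2 δ hδ') γ' hγ' hδ
      dsimp only
      rw [e1, e2, Finset.prod_congr rfl e3]

/-! ### Coassociativity -/

/-- The identity F/D = E: the lift of `η` contracts back to `η`, while members of `D` left as they
are contribute γ/γ = 1. -/
theorem prod_relCograph_liftForest (hG : G.IsAssigned c ρ) {D : Finset (G.HighSubgraph c)}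
    (hD : IsProperForest D) (E : Finset ((G.shrink c D).HighSubgraph c)) :
    ∏ γ ∈ liftForest hD.forest E, relCograph K hG D γ =
      forestUnion K (hD.shrink_isAssigned hG) E := by
  classical
  have hsub : E.map (liftHigh hD.forest) ⊆ liftForest hD.forest E := Finset.subset_union_left
  rw [← Finset.prod_subset hsub, Finset.prod_map]
  · refine Finset.prod_congr rfl fun η _ => ?_
    rw [relCograph, cographOf_pos K _
      ((hD.forest.isProperForest_restrict_iff _).2 (liftHigh_notMem hD.forest η))]
    exact congrArg _ (mk_eq _ _ (liftHighIso hD.forest η).symm)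
  · intro γ hγ hγ'
    refine relCograph_of_mem K hG hD.forest ?_
    rcases (mem_liftForest hD.forest E γ).1 hγ with ⟨η, hη, rfl⟩ | ⟨h, _⟩
    · exact absurd (Finset.mem_map_of_mem _ hη) hγ'
    · exact h

theorem cographOf_liftForest (hG : G.IsAssigned c ρ) {D : Finset (G.HighSubgraph c)}
    (hD : IsProperForest D) {E : Finset ((G.shrink c D).HighSubgraph c)}
    (hE : IsProperForest E) : cographOf K hG (liftForest hD.forest E) =
      cographOf K (hD.shrink_isAssigned hG) E := by
  rw [cographOf_pos K _ hE, cographOf_pos K _ (isProperForest_liftForest hD.forest hE)]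
  exact congrArg _ (mk_eq _ _ (shrinkShrinkIso hG.vert_surjective hD.forest hE.forest).symm)

/-- Both sides sum `D ⊗ F/D ⊗ G/F` over pairs with `D` refining `F`, the right side with `F`
expressed by a forest of `G/D`. The subtraction removes the term `G/D ⊗ 1`, which belongs to no
proper forest of `G/D`. -/
theorem sum_coproduct_forestUnion (hG : G.IsAssigned c ρ) :
    ∑ F ∈ properForests c G, Algebra.TensorProduct.assoc K K K _ _ _
        (coproduct K c ρ (forestUnion K hG F) ⊗ₜ[K] cographOf K hG F) =
      ∑ D ∈ properForests c G, forestUnion K hG D ⊗ₜ[K]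
        (coproduct K c ρ (cographOf K hG D) - cographOf K hG D ⊗ₜ[K] 1) := by
  have h1 : ∀ F ∈ properForests c G, Algebra.TensorProduct.assoc K K K _ _ _
      (coproduct K c ρ (forestUnion K hG F) ⊗ₜ[K] cographOf K hG F) =
      ∑ D ∈ refinements F, forestUnion K hG D ⊗ₜ[K]
        ((∏ γ ∈ F, relCograph K hG D γ) ⊗ₜ[K] cographOf K hG F) := by
    intro F hF
    rw [coproduct_forestUnion K hG (mem_properForests.1 hF).forest, TensorProduct.sum_tmul,
      map_sum]
    rfl
  classical
  -- A refinement of a proper forest is proper, so after the exchange `D` runs over proper forests.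
  rw [Finset.sum_congr rfl h1, Finset.sum_comm' (t' := properForests c G)
    (s' := fun D => (properForests c G).filter fun F => Refines D F)]
  · refine Finset.sum_congr rfl fun D hD => ?_
    rw [mem_properForests] at hD
    rw [← TensorProduct.tmul_sum, cographOf_pos K hG hD, coproduct_X_mk, add_sub_cancel_left]
    congr 1
    refine Finset.sum_bij' (fun F _ => pushForest hD.forest F)
      (fun E _ => liftForest hD.forest E) ?_ ?_ ?_ ?_ ?_
    · intro F hF
      rw [Finset.mem_filter, mem_properForests] at hF
      exact mem_properForests.2 (isProperForest_pushForest hD.forest hF.1 hF.2)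
    · intro E hE
      rw [mem_properForests] at hE
      rw [Finset.mem_filter, mem_properForests]
      exact ⟨isProperForest_liftForest hD.forest hE, refines_liftForest hD.forest E⟩
    · intro F hF
      rw [Finset.mem_filter, mem_properForests] at hF
      exact liftForest_pushForest hD.forest hF.1.forest hF.2
    · intro E _
      exact pushForest_liftForest hD.forest E
    · intro F hF
      rw [Finset.mem_filter, mem_properForests] at hF
      rw [← prod_relCograph_liftForest K hG hD, ← cographOf_liftForest K hG hD
        (isProperForest_pushForest hD.forest hF.1 hF.2),
        liftForest_pushForest hD.forest hF.1.forest hF.2]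
  · intro F D
    rw [mem_properForests, mem_refinements, Finset.mem_filter, mem_properForests,
      mem_properForests]
    exact ⟨fun h => ⟨⟨h.1, h.2.2⟩, h.2.2.isProperForest h.2.1 h.1⟩,
      fun h => ⟨h.1.1, h.2.forest, h.1.2⟩⟩

variable (c ρ)

/-- Beyond `sum_coproduct_forestUnion` only terms with `1` in the last factor remain: `Δ(G) ⊗ 1` on
the left, and on the right `G ⊗ 1 ⊗ 1` together with the subtracted sum of `F ⊗ G/F ⊗ 1`. -/
theorem coproduct_coassoc :
    ((Algebra.TensorProduct.assoc K K K (HopfAlg K c ρ) (HopfAlg K c ρ)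
      (HopfAlg K c ρ)).toAlgHom.comp
        (Algebra.TensorProduct.map (coproduct K c ρ) (AlgHom.id K _))).comp (coproduct K c ρ) =
      (Algebra.TensorProduct.map (AlgHom.id K _) (coproduct K c ρ)).comp (coproduct K c ρ) := by
  refine MvPolynomial.algHom_ext fun Γ => ?_
  obtain ⟨⟨G, hG⟩, rfl⟩ := Quotient.exists_rep Γ
  change Algebra.TensorProduct.assoc K K K _ _ _ (Algebra.TensorProduct.map (coproduct K c ρ)
    (AlgHom.id K _) (coproduct K c ρ (MvPolynomial.X (mk G hG)))) =
    Algebra.TensorProduct.map (AlgHom.id K _) (coproduct K c ρ)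
      (coproduct K c ρ (MvPolynomial.X (mk G hG)))
  rw [coproduct_X_mk K hG]
  simp only [map_add, map_sum, Algebra.TensorProduct.map_tmul, AlgHom.id_apply, map_one]
  rw [sum_coproduct_forestUnion K hG, coproduct_X_mk K hG]
  simp only [TensorProduct.tmul_sub, Finset.sum_sub_distrib, TensorProduct.add_tmul, map_add,
    TensorProduct.sum_tmul, map_sum, Algebra.TensorProduct.assoc_tmul,
    Algebra.TensorProduct.one_def]
  abel

end Coassociativity

end AssignedGraphs

/-! ### Additivity of edge and loop numbers -/

namespace AssignedGraphs

namespace ScaledGraph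

variable {c : LegConvention} {ρ : ℕ} {G : ScaledGraph}

/-! ### Counting edges and vertices -/

/-- The pairing is an involution without fixed points on internal half-edges, so a sum of ones over
them cancels modulo 2. Thus the division by two in `numEdges` is exact. -/
theorem even_card_internal (G : ScaledGraph) : Even (Nat.card G.internal) := by
  classical
  let _ : Fintype G.internal := Fintype.ofFinite _
  have h : ∑ _x : G.internal, (1 : ZMod 2) = 0 :=
    Finset.sum_involution
      (fun x _ => ⟨G.inv x.1, fun h => x.2 (by rw [G.inv_inv] at h; exact h.symm)⟩)
      (fun _ _ => by decide) (fun x _ _ h => x.2 (congrArg Subtype.val h))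
      (fun _ _ => Finset.mem_univ _) (fun x _ => Subtype.ext (G.inv_inv x.1))
  rw [Finset.sum_const, nsmul_one, Finset.card_univ, ZMod.natCast_eq_zero_iff_even] at h
  rwa [Nat.card_eq_fintype_card]

/-- A connected graph has at most one vertex more than it has edges. -/
theorem two_mul_card_le {s : Set G.H} (hne : Nonempty G.V) (hs : ∀ h ∈ s, G.inv h ∈ s)
    (hG : ∀ v w, G.Linked s v w) : 2 * Nat.card G.V ≤ Nat.card s + 2 := by
  classical
  -- Self-loops and parallel edges are dropped, so that the bound for connected simple graphs
  -- applies.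
  let A : SimpleGraph G.V :=
    { Adj := fun v w => v ≠ w ∧ ∃ h ∈ s, G.vert h = v ∧ G.vert (G.inv h) = w
      symm := ⟨fun v w ⟨hvw, h, hh, h1, h2⟩ =>
        ⟨hvw.symm, G.inv h, hs h hh, h2, by rw [G.inv_inv]; exact h1⟩⟩
      loopless := ⟨fun v h => h.1 rfl⟩ }
  have hreach : ∀ v w, G.Linked s v w → A.Reachable v w := by
    intro v w h
    induction h with
    | rel x y h =>
      by_cases hxy : x = y
      · rw [hxy]
      · exact SimpleGraph.Adj.reachable (G := A) ⟨hxy, h⟩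
    | refl x => exact .refl _
    | symm x y _ ih => exact ih.symm
    | trans x y z _ _ ih1 ih2 => exact ih1.trans ih2
  have hconn : A.Connected := ⟨fun v w => hreach v w (hG v w)⟩
  have h1 := hconn.card_vert_le_card_edgeSet_add_one
  let _ : Fintype G.V := Fintype.ofFinite _
  have h2 := A.dart_card_eq_twice_card_edges
  rw [← SimpleGraph.coe_edgeFinset, Nat.card_coe_set_eq, Set.ncard_coe_finset] at h1
  -- A half-edge inducing a dart determines it, so the darts, two for each edge of `A`, inject into
  -- `s`.
  choose f hf using fun d : A.Dart => d.adj.2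
  have h3 : Nat.card A.Dart ≤ Nat.card s := by
    refine Nat.card_le_card_of_injective (fun d => (⟨f d, (hf d).1⟩ : s)) fun d d' hdd => ?_
    have h4 : f d = f d' := congrArg Subtype.val hdd
    apply SimpleGraph.Dart.ext
    refine Prod.ext ?_ ?_
    · exact (hf d).2.1.symm.trans ((congrArg _ h4).trans (hf d').2.1)
    · exact (hf d).2.2.symm.trans ((congrArg (fun h => G.vert (G.inv h)) h4).trans (hf d').2.2)
  rw [Nat.card_eq_fintype_card] at h3
  omega

/-- A 1PI graph has at most as many vertices as edges. -/
theorem IsOnePI.two_mul_card_le (hG : G.IsOnePI) : 2 * Nat.card G.V ≤ Nat.card G.internal := by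
  classical
  obtain ⟨e, he⟩ := hG.nonempty
  -- Cutting `e` leaves the graph connected with two half-edges fewer, which absorbs the summand `2`
  -- in the bound.
  have h1 := ScaledGraph.two_mul_card_le (s := G.internal \ {e, G.inv e}) ⟨G.vert e⟩ (by
    rintro h ⟨hi, hn⟩
    refine ⟨fun h' => hi (by rw [G.inv_inv] at h'; exact h'.symm), ?_⟩
    rintro (h' | h')
    · exact hn (Or.inr (by rw [← h', G.inv_inv]; rfl))
    · exact hn (Or.inl (by
        have := congrArg G.inv h'
        rwa [G.inv_inv, G.inv_inv] at this))) (hG.bridgeless e he)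
  have hsub : ({e, G.inv e} : Set G.H) ⊆ G.internal := by
    rintro h (rfl | rfl)
    · exact he
    · exact fun h' => he (by rw [G.inv_inv] at h'; exact h'.symm)
  have h2 := Set.ncard_sdiff_add_ncard_of_subset hsub (Set.toFinite _)
  rw [Set.ncard_pair (fun h => he h.symm)] at h2
  rw [Nat.card_coe_set_eq] at h1 ⊢
  omega

theorem card_internal_toGraph (γ : G.Subgraph) :
    Nat.card (γ.toGraph c).internal = Nat.card γ.carrier :=
  Nat.card_congr
    { toFun := fun h => ⟨h.1.1, (γ.mem_internal_toGraph h.1).1 h.2⟩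
      invFun := fun h => ⟨⟨h.1, γ.mem_support_of_mem h.2⟩, (γ.mem_internal_toGraph _).2 h.2⟩
      left_inv := fun _ => rfl
      right_inv := fun _ => rfl }

theorem IsForest.card_internal {F : Finset (G.HighSubgraph c)} (hF : IsForest F) :
    Nat.card (G.shrink c F).internal + ∑ γ ∈ F, Nat.card (γ.1.toGraph c).internal =
      Nat.card G.internal := by
  have e : ((G.shrink c F).internal ⊕ Σ γ : F, γ.1.1.carrier) ≃ G.internal :=
    Equiv.ofBijective
      (Sum.elim (fun h => ⟨h.1.1, fun h' => h.2 (Subtype.ext h')⟩)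
        (fun p => ⟨p.2.1, p.1.1.1.subset_internal p.2.2⟩)) (by
      constructor
      · rintro (h | ⟨γ, h⟩) (h' | ⟨γ', h'⟩) heq <;>
          replace heq := congrArg Subtype.val heq
        · exact congrArg Sum.inl (Subtype.ext (Subtype.ext heq))
        · refine absurd h'.2 ?_
          rw [← show h.1.1 = h'.1 from heq]
          exact h.1.2 γ'.1 γ'.2
        · refine absurd h.2 ?_
          rw [show h.1 = h'.1.1 from heq]
          exact h'.1.2 γ.1 γ.2
        · have heq : h.1 = h'.1 := heq
          obtain rfl : γ = γ' := Subtype.ext (hF.eq_of_mem γ.2 γ'.2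
            (γ.1.1.mem_support_of_mem h.2) (heq ▸ γ'.1.1.mem_support_of_mem h'.2))
          rw [Subtype.ext heq]
      · intro h
        by_cases hh : ∀ γ ∈ F, h.1 ∉ γ.1.carrier
        · exact ⟨Sum.inl ⟨⟨h.1, hh⟩, fun h' => h.2 (congrArg Subtype.val h')⟩, rfl⟩
        · push Not at hh
          obtain ⟨γ, hγ, hm⟩ := hh
          exact ⟨Sum.inr ⟨⟨γ, hγ⟩, ⟨h.1, hm⟩⟩, rfl⟩)
  rw [← Nat.card_congr e, Nat.card_sum, Nat.card_sigma,
    Finset.sum_coe_sort F fun γ => Nat.card γ.1.carrier]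
  exact congrArg _ (Finset.sum_congr rfl fun γ _ => card_internal_toGraph γ.1)

/-- With `R` the vertices outside the forest, `G` has `R` and the vertices of the members, the
cograph `R` and one vertex for each member. -/
theorem IsForest.card_vertices {F : Finset (G.HighSubgraph c)} (hF : IsForest F) :
    Nat.card (G.shrink c F).V + ∑ γ ∈ F, Nat.card (γ.1.toGraph c).V =
      Nat.card G.V + F.card := by
  let R : Type := {v : G.V // ∀ γ ∈ F, v ∉ γ.1.support}
  have e₁ : (R ⊕ Σ γ : F, γ.1.1.support) ≃ G.V :=
    Equiv.ofBijective (Sum.elim (fun v => v.1) (fun p => p.2.1)) (by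
      constructor
      · rintro (v | ⟨γ, v⟩) (v' | ⟨γ', v'⟩) heq
        · exact congrArg Sum.inl (Subtype.ext heq)
        · refine absurd v'.2 ?_
          rw [← show v.1 = v'.1 from heq]
          exact v.2 γ'.1 γ'.2
        · refine absurd v.2 ?_
          rw [show v.1 = v'.1 from heq]
          exact v'.2 γ.1 γ.2
        · have heq : v.1 = v'.1 := heq
          obtain rfl : γ = γ' := Subtype.ext (hF.eq_of_mem γ.2 γ'.2 v.2 (heq ▸ v'.2))
          rw [Subtype.ext heq]
      · intro v
        by_cases hv : ∀ γ ∈ F, v ∉ γ.1.support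
        · exact ⟨Sum.inl ⟨v, hv⟩, rfl⟩
        · push Not at hv
          obtain ⟨γ, hγ, hm⟩ := hv
          exact ⟨Sum.inr ⟨⟨γ, hγ⟩, ⟨v, hm⟩⟩, rfl⟩)
  have hr : ∀ γ : G.HighSubgraph c, ∃ v, v ∈ γ.1.support := fun γ =>
    ⟨_, γ.1.mem_support_of_mem γ.nonempty.some_mem⟩
  -- `r γ` represents the single vertex to which `γ` is contracted.
  choose r hr using hr
  have e₂ : (R ⊕ F) ≃ (G.shrink c F).V :=
    Equiv.ofBijective (Sum.elim (fun v => shrinkMk F v.1) (fun γ => shrinkMk F (r γ.1))) (by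
      constructor
      · rintro (v | γ) (v' | γ') heq <;> rcases (hF.mk_eq_iff _ _).1 heq with h | ⟨δ, hδ, h1, h2⟩
        · exact congrArg Sum.inl (Subtype.ext h)
        · exact absurd h1 (v.2 δ hδ)
        · exact absurd (h ▸ hr γ'.1) (v.2 γ'.1 γ'.2)
        · exact absurd h1 (v.2 δ hδ)
        · exact absurd (h ▸ hr γ.1) (v'.2 γ.1 γ.2)
        · exact absurd h2 (v'.2 δ hδ)
        · exact congrArg Sum.inr (Subtype.ext
            (hF.eq_of_mem γ.2 γ'.2 (hr γ.1) (h ▸ hr γ'.1)))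
        · exact congrArg Sum.inr (Subtype.ext ((hF.eq_of_mem γ.2 hδ (hr γ.1) h1).trans
            (hF.eq_of_mem hδ γ'.2 h2 (hr γ'.1))))
      · intro v
        obtain ⟨v, rfl⟩ := Quot.exists_rep v
        by_cases hv : ∀ γ ∈ F, v ∉ γ.1.support
        · exact ⟨Sum.inl ⟨v, hv⟩, rfl⟩
        · push Not at hv
          obtain ⟨γ, hγ, hm⟩ := hv
          exact ⟨Sum.inr ⟨γ, hγ⟩, Quot.sound ⟨γ, hγ, hr γ, hm⟩⟩)
  have h1 := Nat.card_congr e₁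
  have h2 := Nat.card_congr e₂
  rw [Nat.card_sum, Nat.card_sigma, Finset.sum_coe_sort F fun γ => Nat.card γ.1.support] at h1
  rw [Nat.card_sum, Nat.card_eq_fintype_card (α := F), Fintype.card_coe] at h2
  change _ + ∑ γ ∈ F, Nat.card γ.1.support = _
  omega

end ScaledGraph

namespace AssignedGraph

open ScaledGraph

variable {c : LegConvention} {ρ : ℕ}

theorem exists_extraction_of_mem {Γ : AssignedGraph c ρ}
    {p : Multiset (AssignedGraph c ρ) × AssignedGraph c ρ} (hp : p ∈ Γ.extractions) :
    ∃ (G : ScaledGraph) (hG : G.IsAssigned c ρ) (F : G.Extraction c),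
      Γ = mk G hG ∧ p = (parts G hG F, cograph G hG F) := by
  obtain ⟨⟨G, hG⟩, rfl⟩ := Quotient.exists_rep Γ
  obtain ⟨F, _, rfl⟩ := Multiset.mem_map.1 (show p ∈ extractionsOf G hG from hp)
  exact ⟨G, hG, F, rfl, rfl⟩

theorem parts_ne_zero {Γ : AssignedGraph c ρ}
    {p : Multiset (AssignedGraph c ρ) × AssignedGraph c ρ} (hp : p ∈ Γ.extractions) :
    p.1 ≠ 0 := by
  obtain ⟨G, hG, F, rfl, rfl⟩ := exists_extraction_of_mem hp
  obtain ⟨γ, hγ⟩ := F.2.nonempty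
  intro h
  have h1 : mk (γ.1.toGraph c) (toGraph_isAssigned hG γ) ∈ parts G hG F :=
    Multiset.mem_map_of_mem _ hγ
  rw [show parts G hG F = 0 from h] at h1
  exact Multiset.notMem_zero _ h1

theorem two_mul_numEdges {G : ScaledGraph} (hG : G.IsAssigned c ρ) :
    2 * (mk G hG).numEdges = Nat.card G.internal :=
  Nat.two_mul_div_two_of_even G.even_card_internal

theorem numVertices_le_numEdges (Γ : AssignedGraph c ρ) : Γ.numVertices ≤ Γ.numEdges := by
  obtain ⟨⟨G, hG⟩, rfl⟩ := Quotient.exists_rep Γ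
  change (mk G hG).numVertices ≤ (mk G hG).numEdges
  have h1 := two_mul_numEdges hG
  have h2 : 2 * (mk G hG).numVertices ≤ Nat.card G.internal := hG.onePI.two_mul_card_le
  omega

theorem numEdges_pos (Γ : AssignedGraph c ρ) : 0 < Γ.numEdges := by
  obtain ⟨⟨G, hG⟩, rfl⟩ := Quotient.exists_rep Γ
  change 0 < (mk G hG).numEdges
  have h1 := two_mul_numEdges hG
  have : Nonempty G.internal := hG.onePI.nonempty.to_subtype
  have h2 : 0 < Nat.card G.internal := Nat.card_pos
  omega

theorem numLoops_pos (Γ : AssignedGraph c ρ) : 0 < Γ.numLoops := by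
  have := Γ.numVertices_le_numEdges
  rw [numLoops]
  omega

theorem numEdges_extraction {Γ : AssignedGraph c ρ}
    {p : Multiset (AssignedGraph c ρ) × AssignedGraph c ρ} (hp : p ∈ Γ.extractions) :
    (p.1.map numEdges).sum + p.2.numEdges = Γ.numEdges := by
  obtain ⟨G, hG, F, rfl, rfl⟩ := exists_extraction_of_mem hp
  have h1 := two_mul_numEdges hG
  have h2 := two_mul_numEdges (shrink_isAssigned hG F)
  have h3 := IsForest.card_internal F.2.disjoint
  have h4 : ((parts G hG F).map numEdges).sum =
      ∑ γ ∈ F.1, (mk (γ.1.toGraph c) (toGraph_isAssigned hG γ)).numEdges := by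
    rw [parts, Multiset.map_map]; rfl
  have h5 : 2 * ((parts G hG F).map numEdges).sum =
      ∑ γ ∈ F.1, Nat.card (γ.1.toGraph c).internal := by
    rw [h4, Finset.mul_sum]
    exact Finset.sum_congr rfl fun γ _ => two_mul_numEdges _
  change ((parts G hG F).map numEdges).sum + (mk (G.shrink c F.1) _).numEdges = _
  omega

/-- Each extracted component adds one vertex to the total vertex count, and this cancels its own `+
1` in E - V + 1. -/
theorem numLoops_extraction {Γ : AssignedGraph c ρ}
    {p : Multiset (AssignedGraph c ρ) × AssignedGraph c ρ} (hp : p ∈ Γ.extractions) :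
    (p.1.map numLoops).sum + p.2.numLoops = Γ.numLoops := by
  have hE := numEdges_extraction hp
  -- The truncated subtraction in `numLoops` is exact because V ≤ E.
  have hloops : ∀ Γ : AssignedGraph c ρ, Γ.numLoops + Γ.numVertices = Γ.numEdges + 1 := by
    intro Γ
    have := Γ.numVertices_le_numEdges
    rw [numLoops]
    omega
  have hsum : ∀ m : Multiset (AssignedGraph c ρ),
      (m.map numLoops).sum + (m.map numVertices).sum = (m.map numEdges).sum + m.card := by
    intro m
    rw [← Multiset.sum_map_add, Multiset.map_congr rfl fun Γ _ => hloops Γ,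
      Multiset.sum_map_add, Multiset.map_const', Multiset.sum_replicate, smul_eq_mul, mul_one]
  have hV : (p.1.map numVertices).sum + p.2.numVertices = Γ.numVertices + p.1.card := by
    obtain ⟨G, hG, F, rfl, rfl⟩ := exists_extraction_of_mem hp
    have h3 := IsForest.card_vertices F.2.disjoint
    have h4 : ((parts G hG F).map numVertices).sum =
        ∑ γ ∈ F.1, Nat.card (γ.1.toGraph c).V := by
      rw [parts, Multiset.map_map]; rfl
    have h5 : (parts G hG F).card = F.1.card := Multiset.card_map _ _
    change ((parts G hG F).map numVertices).sum + Nat.card (G.shrink c F.1).V =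
      Nat.card G.V + (parts G hG F).card
    omega
  have h1 := hloops p.2
  have h2 := hloops Γ
  have h3 := hsum p.1
  omega

/-- The extracted part is non-empty and has edges. This drives the induction for the right antipode,
as `numEdges_part_lt` drives the recursion for `antipode`. -/
theorem numEdges_cograph_lt {Γ : AssignedGraph c ρ}
    {p : Multiset (AssignedGraph c ρ) × AssignedGraph c ρ} (hp : p ∈ Γ.extractions) :
    p.2.numEdges < Γ.numEdges := by
  have h1 := numEdges_extraction hp
  obtain ⟨γ, hγ⟩ := Multiset.exists_mem_of_ne_zero (parts_ne_zero hp)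
  have h2 := Multiset.le_sum_of_mem (Multiset.mem_map_of_mem numEdges hγ)
  have h3 := γ.numEdges_pos
  omega

theorem numEdges_part_lt {Γ : AssignedGraph c ρ}
    {p : Multiset (AssignedGraph c ρ) × AssignedGraph c ρ} (hp : p ∈ Γ.extractions)
    {γ : AssignedGraph c ρ} (hγ : γ ∈ p.1) : γ.numEdges < Γ.numEdges := by
  have h1 := numEdges_extraction hp
  have h2 := Multiset.le_sum_of_mem (Multiset.mem_map_of_mem numEdges hγ)
  have h3 := p.2.numEdges_pos
  omega

end AssignedGraph

end AssignedGraphs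

/-! ### Connected gradings, counit and antipode -/

namespace AssignedGraphs

open AssignedGraph

section Gradings

variable (K : Type*) [Field K] {c : LegConvention} {ρ : ℕ}

/-! ### Gradings -/

/-- The part of degree `n` of the tensor square. -/
noncomputable def tensorDegree (w : AssignedGraph c ρ → ℕ) (n : ℕ) :
    Submodule K (HopfAlg K c ρ ⊗[K] HopfAlg K c ρ) :=
  Submodule.span K {t | ∃ i j, i + j = n ∧
    ∃ x ∈ MvPolynomial.weightedHomogeneousSubmodule K w i,
    ∃ y ∈ MvPolynomial.weightedHomogeneousSubmodule K w j, t = x ⊗ₜ y}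

theorem tmul_mem_tensorDegree {w : AssignedGraph c ρ → ℕ} {i j n : ℕ} (h : i + j = n)
    {x y : HopfAlg K c ρ} (hx : x.IsWeightedHomogeneous w i) (hy : y.IsWeightedHomogeneous w j) :
    x ⊗ₜ[K] y ∈ tensorDegree K w n :=
  Submodule.subset_span ⟨i, j, h, x, hx, y, hy, rfl⟩

theorem one_mem_tensorDegree (w : AssignedGraph c ρ → ℕ) :
    (1 : HopfAlg K c ρ ⊗[K] HopfAlg K c ρ) ∈ tensorDegree K w 0 :=
  tmul_mem_tensorDegree K (add_zero 0) (MvPolynomial.isWeightedHomogeneous_one K w)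
    (MvPolynomial.isWeightedHomogeneous_one K w)

theorem mul_mem_tensorDegree {w : AssignedGraph c ρ → ℕ} {m n : ℕ}
    {s t : HopfAlg K c ρ ⊗[K] HopfAlg K c ρ} (hs : s ∈ tensorDegree K w m)
    (ht : t ∈ tensorDegree K w n) : s * t ∈ tensorDegree K w (m + n) := by
  have h := Submodule.mul_mem_mul hs ht
  rw [tensorDegree, tensorDegree, Submodule.span_mul_span] at h
  refine Submodule.span_le.2 ?_ h
  rintro _ ⟨_, ⟨i, j, rfl, x, hx, y, hy, rfl⟩, _, ⟨i', j', rfl, x', hx', y', hy', rfl⟩, rfl⟩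
  dsimp only
  rw [Algebra.TensorProduct.tmul_mul_tmul]
  exact tmul_mem_tensorDegree K (by omega) (MvPolynomial.IsWeightedHomogeneous.mul hx hx')
    (MvPolynomial.IsWeightedHomogeneous.mul hy hy')

theorem tensorDegree_le (w : AssignedGraph c ρ → ℕ) (n : ℕ) :
    tensorDegree K w n ≤ ⨆ p ∈ Finset.HasAntidiagonal.antidiagonal n, LinearMap.range
      (TensorProduct.map (MvPolynomial.weightedHomogeneousSubmodule K w p.1).subtype
        (MvPolynomial.weightedHomogeneousSubmodule K w p.2).subtype) := by
  refine Submodule.span_le.2 ?_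
  rintro _ ⟨i, j, hij, x, hx, y, hy, rfl⟩
  exact Submodule.mem_iSup_of_mem (i, j) (Submodule.mem_iSup_of_mem
    (Finset.HasAntidiagonal.mem_antidiagonal.2 hij) ⟨⟨x, hx⟩ ⊗ₜ ⟨y, hy⟩, rfl⟩)

theorem isWeightedHomogeneous_union (w : AssignedGraph c ρ → ℕ)
    (m : Multiset (AssignedGraph c ρ)) :
    (union K c ρ m).IsWeightedHomogeneous w (m.map w).sum := by
  induction m using Multiset.induction_on with
  | empty => simpa [union] using MvPolynomial.isWeightedHomogeneous_one K w
  | cons Γ m ih =>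
    have h : union K c ρ (Γ ::ₘ m) = MvPolynomial.X Γ * union K c ρ m := by simp [union]
    rw [h, Multiset.map_cons, Multiset.sum_cons]
    exact (MvPolynomial.isWeightedHomogeneous_X K w Γ).mul ih

/-- A positive weight which is additive under extraction of subgraphs defines a connected
grading. -/
theorem isConnectedGrading_of_additive (w : AssignedGraph c ρ → ℕ) (hpos : ∀ Γ, 0 < w Γ)
    (hadd : ∀ Γ : AssignedGraph c ρ, ∀ p ∈ Γ.extractions, (p.1.map w).sum + w p.2 = w Γ) :
    IsConnectedGrading (coproduct K c ρ).toLinearMap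
      (MvPolynomial.weightedHomogeneousSubmodule K w) := by
  have hX : ∀ Γ, coproduct K c ρ (MvPolynomial.X Γ) ∈ tensorDegree K w (w Γ) := by
    intro Γ
    rw [coproduct, MvPolynomial.aeval_X]
    have h1 := MvPolynomial.isWeightedHomogeneous_one K w
    have hΓ := MvPolynomial.isWeightedHomogeneous_X K w Γ
    refine add_mem (add_mem (tmul_mem_tensorDegree K (add_zero _) hΓ h1)
      (tmul_mem_tensorDegree K (zero_add _) h1 hΓ)) (multiset_sum_mem _ fun t ht => ?_)
    obtain ⟨p, hp, rfl⟩ := Multiset.mem_map.1 ht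
    exact tmul_mem_tensorDegree K (hadd Γ p hp) (isWeightedHomogeneous_union K w p.1)
      (MvPolynomial.isWeightedHomogeneous_X K w p.2)
  have hmon : ∀ d : AssignedGraph c ρ →₀ ℕ, coproduct K c ρ (MvPolynomial.monomial d 1) ∈
      tensorDegree K w (Finsupp.weight w d) := by
    intro d
    induction d using Finsupp.induction_linear with
    | zero =>
      rw [map_zero, MvPolynomial.monomial_zero', map_one, map_one]
      exact one_mem_tensorDegree K w
    | add d d' h h' =>
      rw [map_add, ← mul_one (1 : K), ← MvPolynomial.monomial_mul, map_mul]
      exact mul_mem_tensorDegree K h h'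
    | single Γ n =>
      rw [← MvPolynomial.X_pow_eq_monomial, map_pow, Finsupp.weight_single]
      induction n with
      | zero => simpa using one_mem_tensorDegree K w
      | succ n ih =>
        rw [pow_succ, succ_nsmul]
        exact mul_mem_tensorDegree K ih (hX Γ)
  refine ⟨?_, fun m n x hx y hy => MvPolynomial.IsWeightedHomogeneous.mul hx hy, ?_, ?_⟩
  · have := MvPolynomial.weightedDecomposition K w
    exact DirectSum.Decomposition.isInternal _
  · intro n x hx
    refine tensorDegree_le K w n ?_
    rw [AlgHom.toLinearMap_apply, x.as_sum, map_sum]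
    refine sum_mem fun d hd => ?_
    rw [← hx (MvPolynomial.mem_support_iff.1 hd), ← mul_one (x.coeff d), ← smul_eq_mul,
      ← MvPolynomial.smul_monomial, map_smul]
    exact Submodule.smul_mem _ _ (hmon d)
  · ext x
    constructor
    · intro hx
      refine ⟨x.coeff 0, ?_⟩
      -- With all weights positive, only the constant monomial has weight zero.
      have h1 := MvPolynomial.weightedHomogeneousComponent_zero x fun Γ => (hpos Γ).ne'
      rw [MvPolynomial.weightedHomogeneousComponent_of_mem hx, if_pos rfl] at h1
      exact h1.symm
    · rintro ⟨a, rfl⟩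
      exact MvPolynomial.isWeightedHomogeneous_C w a

end Gradings

section Antipode

variable (K : Type*) [Field K] (c : LegConvention) (ρ : ℕ)

/-! ### The counit and the antipode -/

theorem coproduct_X (Γ : AssignedGraph c ρ) : coproduct K c ρ (MvPolynomial.X Γ) =
    MvPolynomial.X Γ ⊗ₜ[K] 1 + 1 ⊗ₜ[K] MvPolynomial.X Γ +
      (Γ.extractions.map fun p => union K c ρ p.1 ⊗ₜ[K] MvPolynomial.X p.2).sum :=
  MvPolynomial.aeval_X _ _

theorem counit_X (Γ : AssignedGraph c ρ) : counit K c ρ (MvPolynomial.X Γ) = 0 :=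
  MvPolynomial.aeval_X _ _

theorem counit_union {m : Multiset (AssignedGraph c ρ)} (hm : m ≠ 0) :
    counit K c ρ (union K c ρ m) = 0 := by
  obtain ⟨Γ, hΓ⟩ := Multiset.exists_mem_of_ne_zero hm
  obtain ⟨m, rfl⟩ := Multiset.exists_cons_of_mem hΓ
  rw [union, Multiset.map_cons, Multiset.prod_cons, map_mul, counit_X, zero_mul]

/-- Each unfolding passes to components with fewer edges, and every assigned graph has an edge, so
the default value `0` at stage zero plays no role once the stage is at least the number of edges. -/
theorem antipodeAux_eq_of_le (m n : ℕ) (Γ : AssignedGraph c ρ) (hm : Γ.numEdges ≤ m)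
    (hn : Γ.numEdges ≤ n) : antipodeAux K c ρ m Γ = antipodeAux K c ρ n Γ := by
  induction m generalizing n Γ with
  | zero => exact absurd hm (not_le.2 Γ.numEdges_pos)
  | succ m ih =>
    cases n with
    | zero => exact absurd hn (not_le.2 Γ.numEdges_pos)
    | succ n =>
      rw [antipodeAux, antipodeAux]
      congr 2
      refine Multiset.map_congr rfl fun p hp => ?_
      congr 2
      refine Multiset.map_congr rfl fun γ hγ => ?_
      have := numEdges_part_lt hp hγ
      exact ih n γ (by omega) (by omega)

theorem antipode_X (Γ : AssignedGraph c ρ) : antipode K c ρ (MvPolynomial.X Γ) =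
    - MvPolynomial.X Γ - (Γ.extractions.map fun p =>
      antipode K c ρ (union K c ρ p.1) * MvPolynomial.X p.2).sum := by
  obtain ⟨n, hn⟩ := Nat.exists_eq_succ_of_ne_zero Γ.numEdges_pos.ne'
  conv_lhs => rw [antipode, MvPolynomial.aeval_X, hn, antipodeAux]
  congr 2
  refine Multiset.map_congr rfl fun p hp => ?_
  rw [union, map_multiset_prod, Multiset.map_map]
  congr 2
  refine Multiset.map_congr rfl fun γ hγ => ?_
  have := numEdges_part_lt hp hγ
  rw [Function.comp_apply, antipode, MvPolynomial.aeval_X]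
  exact antipodeAux_eq_of_le K c ρ _ _ γ (by omega) le_rfl

/-- The convolution product of algebra endomorphisms. -/
noncomputable def convolution (f g : HopfAlg K c ρ →ₐ[K] HopfAlg K c ρ) :
    HopfAlg K c ρ →ₐ[K] HopfAlg K c ρ :=
  ((Algebra.TensorProduct.lmul' K).comp (Algebra.TensorProduct.map f g)).comp (coproduct K c ρ)

theorem convolution_apply_X (f g : HopfAlg K c ρ →ₐ[K] HopfAlg K c ρ) (Γ : AssignedGraph c ρ) :
    convolution K c ρ f g (MvPolynomial.X Γ) = f (MvPolynomial.X Γ) + g (MvPolynomial.X Γ) +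
      (Γ.extractions.map fun p => f (union K c ρ p.1) * g (MvPolynomial.X p.2)).sum := by
  rw [convolution, AlgHom.comp_apply, coproduct_X, map_add, map_add, map_multiset_sum,
    Multiset.map_map]
  simp [Function.comp_def]

/-- This is `coproduct_coassoc` combined with associativity of the product. -/
theorem convolution_assoc (f g h : HopfAlg K c ρ →ₐ[K] HopfAlg K c ρ) :
    convolution K c ρ (convolution K c ρ f g) h = convolution K c ρ f (convolution K c ρ g h) := by
  let μ := Algebra.TensorProduct.lmul' K (S := HopfAlg K c ρ)
  let Δ := coproduct K c ρ
  have h1 : μ.comp (Algebra.TensorProduct.map (μ.comp (Algebra.TensorProduct.map f g)) h) =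
      (μ.comp (Algebra.TensorProduct.map f (μ.comp (Algebra.TensorProduct.map g h)))).comp
        (Algebra.TensorProduct.assoc K K K _ _ _).toAlgHom := by
    ext <;> simp [μ, Algebra.TensorProduct.one_def]
  have h2 : Algebra.TensorProduct.map (convolution K c ρ f g) h =
      (Algebra.TensorProduct.map (μ.comp (Algebra.TensorProduct.map f g)) h).comp
        (Algebra.TensorProduct.map Δ (AlgHom.id K _)) := by
    ext <;> simp [convolution, μ, Δ]
  have h3 : Algebra.TensorProduct.map f (convolution K c ρ g h) =
      (Algebra.TensorProduct.map f (μ.comp (Algebra.TensorProduct.map g h))).comp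
        (Algebra.TensorProduct.map (AlgHom.id K _) Δ) := by
    ext <;> simp [convolution, μ, Δ]
  calc convolution K c ρ (convolution K c ρ f g) h
      = (μ.comp (Algebra.TensorProduct.map (μ.comp (Algebra.TensorProduct.map f g)) h)).comp
          ((Algebra.TensorProduct.map Δ (AlgHom.id K _)).comp Δ) := by
        rw [convolution, h2]; rfl
    _ = (μ.comp (Algebra.TensorProduct.map f (μ.comp (Algebra.TensorProduct.map g h)))).comp
          ((Algebra.TensorProduct.map (AlgHom.id K _) Δ).comp Δ) := by
        rw [h1, ← coproduct_coassoc]; rfl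
    _ = convolution K c ρ f (convolution K c ρ g h) := by
        rw [convolution, h3]; rfl

/-- The unit of the convolution product. -/
noncomputable def convolutionUnit : HopfAlg K c ρ →ₐ[K] HopfAlg K c ρ :=
  (Algebra.ofId K _).comp (counit K c ρ)

theorem convolutionUnit_X (Γ : AssignedGraph c ρ) :
    convolutionUnit K c ρ (MvPolynomial.X Γ) = 0 := by
  rw [convolutionUnit, AlgHom.comp_apply, counit_X, map_zero]

theorem convolutionUnit_convolution (f : HopfAlg K c ρ →ₐ[K] HopfAlg K c ρ) :
    convolution K c ρ (convolutionUnit K c ρ) f = f := by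
  refine MvPolynomial.algHom_ext fun Γ => ?_
  rw [convolution_apply_X, convolutionUnit_X, zero_add, Multiset.sum_eq_zero, add_zero]
  intro x hx
  obtain ⟨p, hp, rfl⟩ := Multiset.mem_map.1 hx
  rw [convolutionUnit, AlgHom.comp_apply, counit_union K c ρ (parts_ne_zero hp), map_zero,
    zero_mul]

/-- On a generator this is the recursion for `S` with all terms moved to one side. -/
theorem antipode_convolution_id :
    convolution K c ρ (antipode K c ρ) (AlgHom.id K _) = convolutionUnit K c ρ := by
  refine MvPolynomial.algHom_ext fun Γ => ?_
  rw [convolution_apply_X, convolutionUnit_X, antipode_X]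
  simp only [AlgHom.id_apply]
  abel

/-- By associativity, S ∗ (id ∗ S) = (S ∗ id) ∗ S = S. Evaluated at G, the terms with a proper
cograph vanish by induction, since `id ∗ S` is applied to a graph with fewer edges; what remains is
S(G) + (id ∗ S)(G) = S(G). -/
theorem id_convolution_antipode :
    convolution K c ρ (AlgHom.id K _) (antipode K c ρ) = convolutionUnit K c ρ := by
  have key : convolution K c ρ (antipode K c ρ)
      (convolution K c ρ (AlgHom.id K _) (antipode K c ρ)) = antipode K c ρ := by
    rw [← convolution_assoc, antipode_convolution_id, convolutionUnit_convolution]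
  refine MvPolynomial.algHom_ext fun Γ => ?_
  rw [convolutionUnit_X]
  induction hn : Γ.numEdges using Nat.strong_induction_on generalizing Γ with
  | _ n ih =>
    have h1 := DFunLike.congr_fun key (MvPolynomial.X Γ)
    rw [convolution_apply_X, Multiset.sum_eq_zero, add_zero] at h1
    · exact left_eq_add.1 h1.symm
    · intro x hx
      obtain ⟨p, hp, rfl⟩ := Multiset.mem_map.1 hx
      rw [ih _ (hn ▸ numEdges_cograph_lt hp) p.2 rfl, mul_zero]

/-- Extracted parts are non-empty, so the counit kills them and only `1 ⊗ G` survives. -/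
theorem lid_map_counit : ((Algebra.TensorProduct.lid K (HopfAlg K c ρ)).toAlgHom.comp
    (Algebra.TensorProduct.map (counit K c ρ) (AlgHom.id K _))).comp (coproduct K c ρ) =
      AlgHom.id K _ := by
  refine MvPolynomial.algHom_ext fun Γ => ?_
  rw [AlgHom.comp_apply, coproduct_X, map_add, map_add, map_multiset_sum, Multiset.map_map,
    Multiset.sum_eq_zero]
  · simp [counit_X]
  · intro x hx
    obtain ⟨p, hp, rfl⟩ := Multiset.mem_map.1 hx
    simp [counit_union K c ρ (parts_ne_zero hp)]

theorem rid_map_counit : ((Algebra.TensorProduct.rid K K (HopfAlg K c ρ)).toAlgHom.comp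
    (Algebra.TensorProduct.map (AlgHom.id K _) (counit K c ρ))).comp (coproduct K c ρ) =
      AlgHom.id K _ := by
  refine MvPolynomial.algHom_ext fun Γ => ?_
  rw [AlgHom.comp_apply, coproduct_X, map_add, map_add, map_multiset_sum, Multiset.map_map,
    Multiset.sum_eq_zero]
  · simp [counit_X]
  · intro x hx
    obtain ⟨p, hp, rfl⟩ := Multiset.mem_map.1 hx
    simp [counit_X]

theorem isHopfAlgebra : IsHopfAlgebra (coproduct K c ρ).toLinearMap (counit K c ρ).toLinearMap
    (antipode K c ρ).toLinearMap where
  coassoc := congrArg AlgHom.toLinearMap (coproduct_coassoc K c ρ)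
  counit_left := DFunLike.congr_fun (lid_map_counit K c ρ)
  counit_right := DFunLike.congr_fun (rid_map_counit K c ρ)
  comul_one := map_one (coproduct K c ρ)
  comul_mul := map_mul (coproduct K c ρ)
  counit_one := map_one (counit K c ρ)
  counit_mul := map_mul (counit K c ρ)
  antipode_left := DFunLike.congr_fun (antipode_convolution_id K c ρ)
  antipode_right := DFunLike.congr_fun (id_convolution_antipode K c ρ)

end Antipode

end AssignedGraphs

open AssignedGraphs in
theorem mainTheorem1 (K : Type*) [Field K] (c : LegConvention) (ρ : ℕ) :
    IsHopfAlgebra (coproduct K c ρ).toLinearMap (counit K c ρ).toLinearMap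
        (antipode K c ρ).toLinearMap ∧
      (∀ Γ : AssignedGraph c ρ, antipode K c ρ (MvPolynomial.X Γ) =
        - MvPolynomial.X Γ - (Γ.extractions.map fun p =>
          antipode K c ρ (union K c ρ p.1) * MvPolynomial.X p.2).sum) ∧
      IsConnectedGrading (coproduct K c ρ).toLinearMap
        (MvPolynomial.weightedHomogeneousSubmodule K
          (AssignedGraph.numLoops : AssignedGraph c ρ → ℕ)) ∧
      IsConnectedGrading (coproduct K c ρ).toLinearMap
        (MvPolynomial.weightedHomogeneousSubmodule K
          (AssignedGraph.numEdges : AssignedGraph c ρ → ℕ)) := by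
  exact ⟨isHopfAlgebra K c ρ, antipode_X K c ρ,
    isConnectedGrading_of_additive K _ AssignedGraph.numLoops_pos
      fun _ _ => AssignedGraph.numLoops_extraction,
    isConnectedGrading_of_additive K _ AssignedGraph.numEdges_pos
      fun _ _ => AssignedGraph.numEdges_extraction⟩
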